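/- Let $X$ be a Banach space and let $A\subseteq X\times X$ be an $m$-accretive operator of type $\omega\ge 0$, that is, $\|x-\hat x+\lambda(f-\hat f)\|\ge(1-\lambda\omega)\|x-\hat x\|$ for all $(x,f),(\hat x,\hat f)\in A$, and $I+\lambda A$ is surjective onto $X$, whenever $\lambda>0$ and $\lambda\omega<1$. For $h>0$ let $I+hA=\{(x,x+hf):(x,f)\in A\}$. For $B=A$ or $B=I+hA$ write $\operatorname{dom}B=\{x:\exists f,\ (x,f)\in B\}$, $|Bx|=\inf\{\|f\|:(x,f)\in B\}\in[0,\infty]$ (with $\inf\emptyset=\infty$), $J^B_t=(I+tB)^{-1}$ for $t>0$, $J^B_0x=x$, let $S^B$ be the semigroup on $\overline{\operatorname{dom}B}$ generated by $-B$ (so $t\mapsto S^B(t)x$ is the mild solution of $\dot u+Bu\ni0$, $u(0)=x$), and let $$K^B(x,t)=\inf_{v\in X}\big(\|x-v\|+t\,|Bv|\big).$$ Let $E$ be a Banach function space over $(0,\infty)$: a Banach space of (classes of) complex measurable functions with $L^1\cap L^\infty\subseteq E\subseteq L^1+L^\infty$ such that $|g|\le|f|$ a.e., $g$ measurable and $f\in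 E$ imply $g\in E$ and $\|g\|_E\le\|f\|_E$. Put $\|f\|_E=\infty$ if $f\notin E$. Assume that the Hardy operator $Pf(t)=\frac1t\int_0^tf(s)\,ds$ is bounded on $E$. Let $I\subseteq(0,\infty)$ be an interval $(0,\tau)$ or $(0,\infty)$, with indicator function $\chi_I$. For $x\in X$ and a class $G$ of functions put $$(\mathcal N^B)_{E}^{I}(x)=\Big\|\tfrac{K^B(x,t)}t\chi_I(t)\Big\|_E,\qquad (\mathcal N^B)_{\mathbf E}^{G,I}(x)=\inf_{u\in G}\Big(\Big\|\tfrac{\|x-u(t)\|}t\chi_I(t)\Big\|_E+\big\||Bu(t)|\chi_I(t)\big\|_E\Big),$$ $$(\mathcal N^B)_{\mathbf E}^{tr,I}(x)=\inf\Big\{\big\|\|\dot w(t)\|\chi_I(t)\big\|_E+\big\||Bw(t)|\chi_I(t)\big\|_E : w\in W^{1,1}_{loc}([0,\infty);X),\ w(0)=x\Big\}.$$ (If $t\mapsto|Bu(t)|$ or $t\mapsto |Bw(t)|$ is not measurable, its $E$-norm is understood as the infimum of the norms of its majorants in $E$.) We write $L^0$ for the class of strongly measurable functions $(0,\infty)\to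 X$ and $C$ for the class of continuous functions $[0,\infty)\to X$, and $\operatorname{dom}\mathcal N=\{x\in X:\mathcal N(x)<\infty\}$ for $\mathcal N:X\to[0,\infty]$. Finally $\operatorname{Var}_{J^B_\cdot x}(t)$ is the variation of $s\mapsto J^B_sx$ on $[0,t]$. **Corollary.** Let $\tau,h>0$ with $\tau\omega<1$ and $h\omega<1$. Then there is a set $D$ with $\operatorname{dom}A\subseteq D\subseteq\overline{\operatorname{dom}A}$ which is equal to each of the following sets: 1. $\{x\in X: t\mapsto\frac{\|x-J^A_tx\|}t\chi_{(0,\tau)}(t)\in E\}$ and $\{x\in X:t\mapsto\frac{\|x-J^{I+hA}_tx\|}t\in E\}$; 2. $\{x\in\overline{\operatorname{dom}A}:t\mapsto\frac{\|x-S^B(t)x\|}t\chi_{(0,\tau)}(t)\in E\}$ for $B=A$ and for $B=I+hA$; 3. $\{x\in X:t\mapsto\frac{K^B(x,t)}t\chi_I(t)\in E\}$ and $\operatorname{dom}(\mathcal N^B)^I_E$, for $(B,I)=(A,(0,\tau))$, $(I+hA,(0,\tau))$ and $(I+hA,(0,\infty))$; 4. the set of all $x\in\overline{\operatorname{dom}A}$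 such that $\operatorname{Var}_{J^B_\cdot x}$ is finite on $I$ and $t\mapsto\frac{d}{dt}\operatorname{Var}_{J^B_\cdot x}(t)\,\chi_I(t)\in E$, for $(B,I)=(A,(0,\tau))$ and $(I+hA,(0,\infty))$; it is the same to take all $x\in X$ such that $t\mapsto J^B_tx$ is absolutely continuous on $[0,T]$ for every $T\in I$ and $t\mapsto\frac{d}{dt}\operatorname{Var}_{J^B_\cdot x}(t)\,\chi_I(t)\in E$; 5. $\operatorname{dom}(\mathcal N^B)^{L^0,(0,\tau)}_{\mathbf E}$ and $\operatorname{dom}(\mathcal N^B)^{C,(0,\tau)}_{\mathbf E}$, for $B=A$ and for $B=I+hA$. If moreover $X$ has the Radon–Nikodym property (every absolutely continuous function from a bounded interval to $X$ is the indefinite integral of a Bochner integrable function), then $$\operatorname{dom}(\mathcal N^A)^{(0,\tau)}_E=\operatorname{dom}(\mathcal N^A)^{tr,(0,\tau)}_{\mathbf E}.$$ -/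

import Mathlib

open MeasureTheory Set Filter Topology
open scoped ENNReal

namespace AccretiveInterpolation

/-! ### Banach function spaces over the half line -/

/-- Lebesgue measure on the half line `(0, ∞)`. -/
noncomputable abbrev halfLine : Measure ℝ := volume.restrict (Ioi (0 : ℝ))

/-- A Banach function space over `(0, ∞)`: a Banach space `E` of (classes of) complex measurable
functions with `L¹ ∩ L^∞ ⊆ E ⊆ L¹ + L^∞` that is an order ideal with monotone norm. -/
structure BanachFunctionSpace where
  /-- the underlying space of classes of measurable functions -/
  space : Submodule ℂ (ℝ →ₘ[halfLine] ℂ)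
  /-- the norm -/
  nrm : Seminorm ℂ space
  eq_zero_of_nrm_eq_zero : ∀ f : space, nrm f = 0 → f = 0
  complete : ∀ u : ℕ → space,
    (∀ ε > 0, ∃ N, ∀ m ≥ N, ∀ n ≥ N, nrm (u m - u n) < ε) →
      ∃ f : space, Tendsto (fun n => nrm (u n - f)) atTop (𝓝 0)
  mem_of_memLp : ∀ f : ℝ →ₘ[halfLine] ℂ, MemLp f 1 halfLine → MemLp f ⊤ halfLine → f ∈ space
  exists_add_of_mem : ∀ f ∈ space, ∃ g h : ℝ →ₘ[halfLine] ℂ,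
    MemLp g 1 halfLine ∧ MemLp h ⊤ halfLine ∧ f = g + h
  ideal : ∀ (f : space) (g : ℝ →ₘ[halfLine] ℂ),
    (∀ᵐ t ∂halfLine, ‖g t‖ ≤ ‖(f : ℝ →ₘ[halfLine] ℂ) t‖) →
      ∃ hg : g ∈ space, nrm ⟨g, hg⟩ ≤ nrm f

namespace BanachFunctionSpace

variable (E : BanachFunctionSpace)

/-- The real function `f` on `(0, ∞)` belongs to `E`. -/
def Mem (f : ℝ → ℝ) : Prop :=
  ∃ g ∈ E.space, ∀ᵐ t ∂halfLine, g t = (f t : ℂ)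

/-- The `[0, ∞]`-valued function `f` on `(0, ∞)` is finite almost everywhere and belongs to `E`. -/
def MemExt (f : ℝ → ℝ≥0∞) : Prop :=
  ∃ g ∈ E.space, ∀ᵐ t ∂halfLine, f t ≠ ⊤ ∧ g t = ((f t).toReal : ℂ)

/-- The norm in `E` of a `[0, ∞]`-valued function `f` on `(0, ∞)`, with the value `∞` if `f` is
not in `E`. It is written as an infimum of the norms of the majorants of `f`, so that it also makes
sense without measurability of `f`; see `extNorm_eq` and `extNorm_lt_top_iff` for measurable `f`. -/
noncomputable def extNorm (f : ℝ → ℝ≥0∞) : ℝ≥0∞ :=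
  ⨅ (g : E.space) (_ : ∀ᵐ t ∂halfLine, f t ≤ ‖(g : ℝ →ₘ[halfLine] ℂ) t‖ₑ),
    ENNReal.ofReal (E.nrm g)

/-- The Hardy operator `f ↦ (t ↦ t⁻¹ ∫₀ᵗ f(s) ds)` maps `E` into `E` and is bounded there. -/
def HardyBounded : Prop :=
  ∃ C : ℝ, ∀ f : E.space, ∃ g : E.space,
    (∀ᵐ t ∂halfLine, (g : ℝ →ₘ[halfLine] ℂ) t =
      (t : ℂ)⁻¹ * ∫ s in (0 : ℝ)..t, (f : ℝ →ₘ[halfLine] ℂ) s) ∧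
    E.nrm g ≤ C * E.nrm f

/-- If `f` belongs to `E`, then `extNorm f` is the norm of `f`. -/
theorem extNorm_eq {f : ℝ → ℝ≥0∞} (g : E.space)
    (hg : ∀ᵐ t ∂halfLine, f t ≠ ⊤ ∧ (g : ℝ →ₘ[halfLine] ℂ) t = ((f t).toReal : ℂ)) :
    E.extNorm f = ENNReal.ofReal (E.nrm g) := by
  have key : ∀ᵐ t ∂halfLine, f t = ‖(g : ℝ →ₘ[halfLine] ℂ) t‖ₑ := by
    filter_upwards [hg] with t ht
    rw [ht.2, ← ofReal_norm, Complex.norm_real, Real.norm_of_nonneg ENNReal.toReal_nonneg,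
      ENNReal.ofReal_toReal ht.1]
  refine le_antisymm (iInf₂_le g (key.mono fun t ht => ht.le)) (le_iInf₂ fun k hk => ?_)
  obtain ⟨_, h⟩ := E.ideal k g (by
    filter_upwards [key, hk] with t h1 h2
    rw [h1, enorm_le_iff_norm_le] at h2
    exact h2)
  exact ENNReal.ofReal_le_ofReal h

/-- For measurable `f`, `extNorm f` is finite exactly when `f` belongs to `E`. -/
theorem extNorm_lt_top_iff {f : ℝ → ℝ≥0∞} (hf : AEMeasurable f halfLine) :
    E.extNorm f < ⊤ ↔ E.MemExt f := by
  constructor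
  · intro h
    simp only [extNorm, iInf_lt_iff] at h
    obtain ⟨k, hk, -⟩ := h
    have hm : AEStronglyMeasurable (fun t => ((f t).toReal : ℂ)) halfLine :=
      (Complex.measurable_ofReal.comp_aemeasurable hf.ennreal_toReal).aestronglyMeasurable
    obtain ⟨hg, -⟩ := E.ideal k (AEEqFun.mk _ hm) (by
      filter_upwards [hk, AEEqFun.coeFn_mk _ hm] with t h1 h2
      rw [h2, Complex.norm_real, Real.norm_of_nonneg ENNReal.toReal_nonneg]
      rw [← ofReal_norm] at h1
      exact ENNReal.toReal_le_of_le_ofReal (norm_nonneg _) h1)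
    refine ⟨_, hg, ?_⟩
    filter_upwards [hk, AEEqFun.coeFn_mk _ hm] with t h1 h2
    exact ⟨(h1.trans_lt enorm_lt_top).ne, h2⟩
  · rintro ⟨g, hg, h⟩
    rw [E.extNorm_eq ⟨g, hg⟩ h]
    exact ENNReal.ofReal_lt_top

end BanachFunctionSpace

/-! ### Interpolation functions

Below, `N₀` and `N₁` are `[0, ∞]`-valued functions on `X`, and `I` is `Ioi 0` for the interpolation
functions on the whole half line and `Ioo 0 τ` for the finite variants. -/

section Interpolation

variable {X : Type*} [NormedAddCommGroup X] [NormedSpace ℝ X]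

/-- The effective domain of a `[0, ∞]`-valued function. -/
def effDom (N : X → ℝ≥0∞) : Set X := {x | N x < ⊤}

/-- The `K`-function `K(x, t) = inf_v (N₀(x - v) + t N₁(v))`. -/
noncomputable def kFun (N₀ N₁ : X → ℝ≥0∞) (x : X) (t : ℝ) : ℝ≥0∞ :=
  ⨅ v : X, N₀ (x - v) + ENNReal.ofReal t * N₁ v

/-- The interpolation function of the `K`-method. -/
noncomputable def kMethod (N₀ N₁ : X → ℝ≥0∞) (E : BanachFunctionSpace) (I : Set ℝ) (x : X) :
    ℝ≥0∞ :=
  E.extNorm (I.indicator fun t => kFun N₀ N₁ x t / ENNReal.ofReal t)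

/-- The interpolation function of the mean method with respect to a class `G` of functions. -/
noncomputable def meanMethod (N₀ N₁ : X → ℝ≥0∞) (E₀ E₁ : BanachFunctionSpace)
    (G : Set (ℝ → X)) (I : Set ℝ) (x : X) : ℝ≥0∞ :=
  ⨅ u ∈ G, E₀.extNorm (I.indicator fun t => N₀ (x - u t) / ENNReal.ofReal t) +
    E₁.extNorm (I.indicator fun t => N₁ (u t))

/-- The class of (strongly) measurable functions `(0, ∞) → X`. -/
def measurableFunctions (X : Type*) [NormedAddCommGroup X] : Set (ℝ → X) :=
  {u | AEStronglyMeasurable u halfLine}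

/-- The class of continuous functions `[0, ∞) → X`. -/
def continuousFunctions (X : Type*) [NormedAddCommGroup X] : Set (ℝ → X) :=
  {u | ContinuousOn u (Ici 0)}

/-- `w` belongs to `W^{1,1}_loc([0, ∞); X)` (and is its continuous representative), with
derivative `w'`. -/
def IsW11Loc (w w' : ℝ → X) : Prop :=
  (∀ T > 0, IntegrableOn w' (Ioc 0 T)) ∧ ∀ t ≥ 0, w t = w 0 + ∫ s in (0 : ℝ)..t, w' s

/-- The interpolation function of the trace method. -/
noncomputable def traceMethod (N₀ N₁ : X → ℝ≥0∞) (E₀ E₁ : BanachFunctionSpace) (I : Set ℝ)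
    (x : X) : ℝ≥0∞ :=
  ⨅ (w : ℝ → X) (w' : ℝ → X) (_ : IsW11Loc w w') (_ : w 0 = x),
    E₀.extNorm (I.indicator fun t => N₀ (w' t)) + E₁.extNorm (I.indicator fun t => N₁ (w t))

/-- The variation function `Var_f(t)` of `f : [0, τ) → X`, the supremum of
`∑ ‖f(sᵢ₊₁) - f(sᵢ)‖` over `0 ≤ s₀ ≤ ⋯ ≤ sₙ ≤ t`. -/
noncomputable def variation (f : ℝ → X) (t : ℝ) : ℝ≥0∞ := eVariationOn f (Icc 0 t)

/-- The derivative of the variation function. -/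
noncomputable def derivVariation (f : ℝ → X) (t : ℝ) : ℝ :=
  deriv (fun s => (variation f s).toReal) t

/-- `f` is absolutely continuous on every interval `[0, T]` whose interior lies in `I`, where `I` is
`(0, τ)` or `(0, ∞)`. -/
def IsACLoc (f : ℝ → X) (I : Set ℝ) : Prop :=
  ∀ T ∈ I, AbsolutelyContinuousOnInterval f 0 T

/-- The Radon-Nikodym property: every absolutely continuous function on a bounded interval with
values in `X` is the indefinite integral of a Bochner integrable function. -/
def HasRadonNikodymProperty (X : Type*) [NormedAddCommGroup X] [NormedSpace ℝ X] : Prop :=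
  ∀ τ > (0 : ℝ), ∀ f : ℝ → X, AbsolutelyContinuousOnInterval f 0 τ →
    ∃ g : ℝ → X, IntegrableOn g (Ioc 0 τ) ∧ ∀ t ∈ Icc 0 τ, f t = f 0 + ∫ s in (0 : ℝ)..t, g s

end Interpolation

/-! ### Accretive operators -/

section Accretive

variable {X : Type*} [NormedAddCommGroup X] [NormedSpace ℝ X]

/-- The domain of a multivalued operator, given by its graph. -/
def dom (A : Set (X × X)) : Set X := {x | ∃ f, (x, f) ∈ A}

/-- The set norm `|Ax| = inf {‖f‖ : f ∈ Ax}`, with `inf ∅ = ∞`. -/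
noncomputable def setNorm (A : Set (X × X)) (x : X) : ℝ≥0∞ :=
  ⨅ (f : X) (_ : (x, f) ∈ A), ‖f‖ₑ

/-- `A` is accretive of type `ω`. -/
def IsAccretive (ω : ℝ) (A : Set (X × X)) : Prop :=
  ∀ p ∈ A, ∀ q ∈ A, ∀ r : ℝ, 0 < r → r * ω < 1 →
    (1 - r * ω) * ‖p.1 - q.1‖ ≤ ‖p.1 - q.1 + r • (p.2 - q.2)‖

/-- `A` is `m`-accretive of type `ω`. -/
def IsMAccretive (ω : ℝ) (A : Set (X × X)) : Prop :=
  IsAccretive ω A ∧ ∀ r : ℝ, 0 < r → r * ω < 1 → ∀ y : X, ∃ p ∈ A, p.1 + r • p.2 = y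

/-- The operator `I + hA`. -/
def idAdd (h : ℝ) (A : Set (X × X)) : Set (X × X) :=
  {p | ∃ f, (p.1, f) ∈ A ∧ p.2 = p.1 + h • f}

open Classical in
/-- The resolvent `J_r y = (I + rA)⁻¹ y`. The value `0` is used only when `y` is not in the range of
`I + rA`. -/
noncomputable def resolv (A : Set (X × X)) (r : ℝ) (y : X) : X :=
  if h : ∃ v f, (v, f) ∈ A ∧ v + r • f = y then h.choose else 0

/-- The curve `r ↦ J_r x` on `[0, ∞)`, with `J_0 x = x`. -/
noncomputable def resolvCurve (A : Set (X × X)) (x : X) (r : ℝ) : X :=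
  if 0 < r then resolv A r x else x

/-- `u` is a mild solution on `[0, ∞)` of `u' + Au ∋ 0`, `u(0) = x`: a continuous function which, on
each `[0, T]` and for each `ε > 0`, is uniformly `ε`-close to a step function with values `v i` that
solves an implicit Euler scheme `(v (i+1) - v i) / (t (i+1) - t i) + A (v (i+1)) ∋ g (i+1)` with
step sizes at most `ε` and total error at most `ε`. -/
def IsMildSolution (A : Set (X × X)) (x : X) (u : ℝ → X) : Prop :=
  ContinuousOn u (Ici 0) ∧ u 0 = x ∧
  ∀ T > 0, ∀ ε > 0, ∃ (N : ℕ) (t : ℕ → ℝ) (v g : ℕ → X),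
    t 0 = 0 ∧ (∀ i < N, t i < t (i + 1) ∧ t (i + 1) - t i ≤ ε) ∧ T - ε < t N ∧ t N ≤ T ∧
    (∀ i < N, (v (i + 1), g (i + 1) - (t (i + 1) - t i)⁻¹ • (v (i + 1) - v i)) ∈ A) ∧
    ∑ i ∈ Finset.range N, (t (i + 1) - t i) * ‖g (i + 1)‖ ≤ ε ∧
    ‖v 0 - x‖ ≤ ε ∧
    ∀ i < N, ∀ s ∈ Ioc (t i) (t (i + 1)), ‖u s - v (i + 1)‖ ≤ ε

open Classical in
/-- The semigroup `S(t)x` generated by `-A`, for `x` in the closure of the domain of `A` and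
`t ≥ 0`: the value at time `t` of the mild solution of `u' + Au ∋ 0`, `u(0) = x`. The default value
is used only where there is no mild solution. -/
noncomputable def semigroup (A : Set (X × X)) (t : ℝ) (x : X) : X :=
  if h : ∃ u, IsMildSolution A x u then h.choose t else 0

/-- The interpolation function of the `K`-method for the couple `(‖·‖, |A·|)`. -/
noncomputable def opK (A : Set (X × X)) (E : BanachFunctionSpace) (I : Set ℝ) : X → ℝ≥0∞ :=
  kMethod (fun x => ‖x‖ₑ) (setNorm A) E I

/-- The interpolation function of the mean method for the couples `(‖·‖, |A·|)` and `(E, E)`. -/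
noncomputable def opMean (A : Set (X × X)) (E : BanachFunctionSpace) (G : Set (ℝ → X))
    (I : Set ℝ) : X → ℝ≥0∞ :=
  meanMethod (fun x => ‖x‖ₑ) (setNorm A) E E G I

/-- The interpolation function of the trace method for the couples `(‖·‖, |A·|)` and `(E, E)`. -/
noncomputable def opTrace (A : Set (X × X)) (E : BanachFunctionSpace) (I : Set ℝ) : X → ℝ≥0∞ :=
  traceMethod (fun x => ‖x‖ₑ) (setNorm A) E E I

/-- The `x ∈ X` such that `t ↦ ‖x - J_t x‖ / t`, restricted to `I`, belongs to `E`. -/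
def resolvSet (A : Set (X × X)) (E : BanachFunctionSpace) (I : Set ℝ) : Set X :=
  {x | E.Mem (I.indicator fun t => ‖x - resolv A t x‖ / t)}

/-- The `x` in the closure of the domain of `A` such that `t ↦ ‖x - S(t)x‖ / t`, restricted to `I`,
belongs to `E`. -/
def semigroupSet (A : Set (X × X)) (E : BanachFunctionSpace) (I : Set ℝ) : Set X :=
  {x | x ∈ closure (dom A) ∧ E.Mem (I.indicator fun t => ‖x - semigroup A t x‖ / t)}

/-- The `x ∈ X` such that `t ↦ K(x, t) / t`, restricted to `I`, belongs to `E`. -/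
def kSet (A : Set (X × X)) (E : BanachFunctionSpace) (I : Set ℝ) : Set X :=
  {x | E.MemExt (I.indicator fun t =>
    kFun (fun x => ‖x‖ₑ) (setNorm A) x t / ENNReal.ofReal t)}

/-- The `x` in the closure of the domain of `A` such that the variation function of `t ↦ J_t x` is
finite on `I` and its derivative, restricted to `I`, belongs to `E`. -/
def variationSet (A : Set (X × X)) (E : BanachFunctionSpace) (I : Set ℝ) : Set X :=
  {x | x ∈ closure (dom A) ∧ (∀ t ∈ I, variation (resolvCurve A x) t < ⊤) ∧
    E.Mem (I.indicator (derivVariation (resolvCurve A x)))}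

/-- The `x ∈ X` such that `t ↦ J_t x` (with `J_0 x = x`) is locally absolutely continuous up to `0`
and the derivative of its variation function, restricted to `I`, belongs to `E`. -/
def acVariationSet (A : Set (X × X)) (E : BanachFunctionSpace) (I : Set ℝ) : Set X :=
  {x | IsACLoc (resolvCurve A x) I ∧ E.Mem (I.indicator (derivVariation (resolvCurve A x)))}

end Accretive

end AccretiveInterpolation

open AccretiveInterpolation

/-! Every set is compared with D, the set of x for which q(t) = ‖x - J_t x‖ / t, restricted to (0,
τ), lies in E. Membership in E amounts to measurability plus having a majorant in E, so each
inclusion reduces to an inequality that bounds one function pointwise by multiples of others or of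
their Hardy transforms.

K-method and mean method: choosing v = J_t x in the infimum gives K(x, t) ≤ 2 ‖x - J_t x‖, and
nonexpansiveness of J_t up to the factor 1 / (1 - tω) gives ‖x - J_t x‖ ≤ C K(x, t). For the mean
method, v = u(t) bounds K by the two terms of the norm, and u(t) = J_t x is an admissible
competitor.

The operator I + hA is m-accretive of type 0, so its resolvents live on the whole half line. Its
K-function is comparable with that of A up to an error O(t), harmless on a bounded interval
(`kSet_idAdd`). It also has a zero, so K is bounded and K / t decays like 1 / t. Such a tail belongs
to E by the Hardy inequality (`kSet_Ioi_eq_of_zero`).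

Variation and trace method: comparing resolvents at two parameters shows that q is decreasing up to
a constant (`quotient_le`) and that t ↦ J_t x has local Lipschitz constant at most C q(t). Hence the
variation V satisfies |V'| ≤ C q. Conversely ‖x - J_t x‖ ≤ ∫_0^t |V'|, so q is dominated by a Hardy
transform. The trace method is the same argument with w' in place of V'; the Radon-Nikodym property
provides w'.

Semigroup: two estimates are proved on implicit Euler schemes and passed to the limit. One gives ‖x
- S(t)x‖ ≤ C K(x, t). The other, `IsMildSolution.norm_sub_resolv_le`, bounds ‖x - J_t x‖ by ‖x -
S(t)x‖ and its mean over (0, t), where Hardy enters again. Existence of S is the Crandall-Liggett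
theorem, proved here by a double induction on the iterates of two resolvents. -/

namespace AccretiveInterpolation

set_option linter.unusedSectionVars false

/-! ### Majorants in a Banach function space and the Hardy operator -/

namespace BanachFunctionSpace

variable {E : BanachFunctionSpace} {f g : ℝ → ℝ≥0∞}

/-- The `[0, ∞]`-valued function `f` is dominated almost everywhere by the modulus of an element
of `E`. -/
def IsMajorized (E : BanachFunctionSpace) (f : ℝ → ℝ≥0∞) : Prop :=
  ∃ g : E.space, ∀ᵐ t ∂halfLine, f t ≤ ‖(g : ℝ →ₘ[halfLine] ℂ) t‖ₑ

theorem extNorm_lt_top_iff_isMajorized : E.extNorm f < ⊤ ↔ E.IsMajorized f := by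
  simp [extNorm, iInf_lt_iff, IsMajorized]

theorem IsMajorized.mono (hf : E.IsMajorized f) (h : ∀ᵐ t ∂halfLine, g t ≤ f t) :
    E.IsMajorized g := by
  obtain ⟨k, hk⟩ := hf
  exact ⟨k, by filter_upwards [hk, h] with t h1 h2 using h2.trans h1⟩

/-- Separates measurability from size, so that the later inclusions need only pointwise domination.
-/
theorem memExt_iff : E.MemExt f ↔ AEMeasurable f halfLine ∧ E.IsMajorized f := by
  constructor
  · intro h
    obtain ⟨g, hg, h⟩ := h
    have key : ∀ᵐ t ∂halfLine, f t = ‖g t‖ₑ := by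
      filter_upwards [h] with t ht
      rw [ht.2, ← ofReal_norm, Complex.norm_real, Real.norm_of_nonneg ENNReal.toReal_nonneg,
        ENNReal.ofReal_toReal ht.1]
    refine ⟨?_, ⟨g, hg⟩, key.mono fun t ht => ht.le⟩
    have : AEMeasurable (fun t => ‖g t‖ₑ) halfLine := g.aestronglyMeasurable.enorm
    exact this.congr (key.mono fun t ht => ht.symm)
  · rintro ⟨h1, h2⟩
    rwa [← E.extNorm_lt_top_iff h1, extNorm_lt_top_iff_isMajorized]

theorem mem_iff {f : ℝ → ℝ} :
    E.Mem f ↔ AEMeasurable f halfLine ∧ E.IsMajorized (fun t => ‖f t‖ₑ) := by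
  constructor
  · rintro ⟨g, hg, h⟩
    refine ⟨?_, ⟨g, hg⟩, ?_⟩
    · have : AEMeasurable (fun t => (g t).re) halfLine :=
        Complex.measurable_re.comp_aemeasurable g.aestronglyMeasurable.aemeasurable
      refine this.congr ?_
      filter_upwards [h] with t ht
      simp [ht]
    · filter_upwards [h] with t ht
      rw [ht, ← ofReal_norm (f t : ℂ), Complex.norm_real, ofReal_norm]
  · rintro ⟨hf, k, hk⟩
    have hm : AEStronglyMeasurable (fun t => (f t : ℂ)) halfLine :=
      (Complex.measurable_ofReal.comp_aemeasurable hf).aestronglyMeasurable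
    obtain ⟨hg, -⟩ := E.ideal k (AEEqFun.mk _ hm) (by
      filter_upwards [hk, AEEqFun.coeFn_mk _ hm] with t h1 h2
      rwa [h2, ← enorm_le_iff_norm_le, ← ofReal_norm (f t : ℂ), Complex.norm_real, ofReal_norm])
    exact ⟨_, hg, AEEqFun.coeFn_mk _ hm⟩

/-- A majorant in `E` may be taken real and nonnegative. -/
theorem IsMajorized.exists_eq_norm (hf : E.IsMajorized f) :
    ∃ (g : E.space), (∀ᵐ t ∂halfLine, f t ≤ ‖(g : ℝ →ₘ[halfLine] ℂ) t‖ₑ) ∧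
      ∀ᵐ t ∂halfLine, (g : ℝ →ₘ[halfLine] ℂ) t = (‖(g : ℝ →ₘ[halfLine] ℂ) t‖ : ℂ) := by
  obtain ⟨k, hk⟩ := hf
  have hm : AEStronglyMeasurable (fun t => (‖(k : ℝ →ₘ[halfLine] ℂ) t‖ : ℂ)) halfLine :=
    (Complex.measurable_ofReal.comp_aemeasurable
      (k : ℝ →ₘ[halfLine] ℂ).aestronglyMeasurable.norm.aemeasurable).aestronglyMeasurable
  obtain ⟨hg, -⟩ := E.ideal k (AEEqFun.mk _ hm) (by
    filter_upwards [AEEqFun.coeFn_mk _ hm] with t h2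
    simp [h2])
  refine ⟨⟨_, hg⟩, ?_, ?_⟩
  · filter_upwards [AEEqFun.coeFn_mk _ hm, hk] with t h2 h1
    rw [h2, ← ofReal_norm, Complex.norm_real, norm_norm, ofReal_norm]
    exact h1
  · filter_upwards [AEEqFun.coeFn_mk _ hm] with t h2
    simp [h2]

theorem IsMajorized.add (hf : E.IsMajorized f) (hg : E.IsMajorized g) :
    E.IsMajorized (fun t => f t + g t) := by
  obtain ⟨k, hk, hk'⟩ := hf.exists_eq_norm
  obtain ⟨l, hl, hl'⟩ := hg.exists_eq_norm
  refine ⟨k + l, ?_⟩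
  filter_upwards [hk, hk', hl, hl', AEEqFun.coeFn_add (k : ℝ →ₘ[halfLine] ℂ) l]
    with t h1 h2 h3 h4 h5
  rw [Submodule.coe_add, h5, Pi.add_apply, h2, h4, ← Complex.ofReal_add, ← ofReal_norm,
    Complex.norm_real, Real.norm_of_nonneg (by positivity),
    ENNReal.ofReal_add (norm_nonneg _) (norm_nonneg _), ofReal_norm, ofReal_norm]
  exact add_le_add h1 h3

theorem IsMajorized.const_mul (hf : E.IsMajorized f) {c : ℝ≥0∞} (hc : c ≠ ⊤) :
    E.IsMajorized (fun t => c * f t) := by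
  obtain ⟨k, hk⟩ := hf
  refine ⟨(c.toReal : ℂ) • k, ?_⟩
  filter_upwards [hk, AEEqFun.coeFn_smul (c.toReal : ℂ) (k : ℝ →ₘ[halfLine] ℂ)] with t h1 h2
  rw [Submodule.coe_smul, h2, Pi.smul_apply, smul_eq_mul, enorm_mul]
  have : ‖(c.toReal : ℂ)‖ₑ = c := by
    rw [← ofReal_norm, Complex.norm_real, Real.norm_of_nonneg ENNReal.toReal_nonneg,
      ENNReal.ofReal_toReal hc]
  rw [this]
  gcongr

/-- This is where E ⊆ L¹ + L^∞ enters: both parts are integrable on a bounded interval. -/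
theorem IsMajorized.lintegral_lt_top (hf : E.IsMajorized f) (T : ℝ) :
    ∫⁻ s in Ioc 0 T, f s < ⊤ := by
  obtain ⟨k, hk⟩ := hf
  obtain ⟨g, h, hg, hh, hgh⟩ := E.exists_add_of_mem k k.2
  have hle : (volume.restrict (Ioc 0 T)) ≤ halfLine :=
    Measure.restrict_mono Ioc_subset_Ioi_self le_rfl
  have hkg : ∀ᵐ t ∂halfLine, f t ≤ ‖g t‖ₑ + ‖h t‖ₑ := by
    filter_upwards [hk, AEEqFun.coeFn_add g h] with t h1 h2
    rw [hgh, h2, Pi.add_apply] at h1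
    exact h1.trans (enorm_add_le _ _)
  refine (lintegral_mono_ae (ae_mono hle hkg)).trans_lt ?_
  have hg' : Integrable g (volume.restrict (Ioc 0 T)) := (memLp_one_iff_integrable.1 hg).mono_measure hle
  have hh' : Integrable h (volume.restrict (Ioc 0 T)) :=
    memLp_one_iff_integrable.1 ((hh.mono_measure hle).mono_exponent le_top)
  rw [lintegral_add_left' hg'.1.enorm]
  exact ENNReal.add_lt_top.2 ⟨hg'.2, hh'.2⟩

theorem isMajorized_indicator_const (c : ℝ≥0∞) (hc : c ≠ ⊤) (T : ℝ) :
    E.IsMajorized ((Iic T).indicator fun _ => c) := by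
  have hle : (halfLine.restrict (Iic T)) = volume.restrict (Ioc 0 T) := by
    rw [halfLine, Measure.restrict_restrict measurableSet_Iic, inter_comm, Ioi_inter_Iic]
  let φ : ℝ → ℂ := (Iic T).indicator fun _ => (c.toReal : ℂ)
  have hm : AEStronglyMeasurable φ halfLine :=
    (measurable_const.indicator measurableSet_Iic).aestronglyMeasurable
  have h1 : MemLp φ 1 halfLine := by
    rw [memLp_one_iff_integrable, integrable_indicator_iff measurableSet_Iic, IntegrableOn, hle]
    exact integrable_const _
  have h2 : MemLp φ ⊤ halfLine := by
    refine memLp_top_of_bound hm ‖(c.toReal : ℂ)‖ (Eventually.of_forall fun t => ?_)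
    simp only [φ, indicator]
    split_ifs <;> simp
  have e := AEEqFun.coeFn_mk φ hm
  refine ⟨⟨AEEqFun.mk φ hm, E.mem_of_memLp _ ((memLp_congr_ae e).2 h1)
    ((memLp_congr_ae e).2 h2)⟩, ?_⟩
  filter_upwards [e] with t ht
  rw [ht]
  simp only [φ, indicator]
  split_ifs
  · rw [← ofReal_norm, Complex.norm_real, Real.norm_of_nonneg ENNReal.toReal_nonneg,
      ENNReal.ofReal_toReal hc]
  · simp

/-- Boundedness of P is stated for complex functions. Passing to a nonnegative majorant first turns
the Bochner integral into a lower Lebesgue integral, with no cancellation. -/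
theorem IsMajorized.hardy (hE : E.HardyBounded) (hf : E.IsMajorized f) :
    E.IsMajorized (fun t => (∫⁻ s in Ioc 0 t, f s) / ENNReal.ofReal t) := by
  obtain ⟨C, hC⟩ := hE
  obtain ⟨k, hk, hk'⟩ := hf.exists_eq_norm
  obtain ⟨g, hg, -⟩ := hC k
  refine ⟨g, ?_⟩
  filter_upwards [hg, ae_restrict_mem measurableSet_Ioi] with t h1 (ht : 0 < t)
  have hle : (volume.restrict (Ioc 0 t)) ≤ halfLine :=
    Measure.restrict_mono Ioc_subset_Ioi_self le_rfl
  have hint : ∫⁻ s in Ioc 0 t, ‖(k : ℝ →ₘ[halfLine] ℂ) s‖ₑ < ⊤ :=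
    IsMajorized.lintegral_lt_top ⟨k, Eventually.of_forall fun _ => le_rfl⟩ t
  have hkint : Integrable (fun s => ‖(k : ℝ →ₘ[halfLine] ℂ) s‖) (volume.restrict (Ioc 0 t)) :=
    Integrable.norm ⟨(k : ℝ →ₘ[halfLine] ℂ).aestronglyMeasurable.mono_measure hle, hint⟩
  have e : ∫ s in (0 : ℝ)..t, (k : ℝ →ₘ[halfLine] ℂ) s =
      ((∫ s in Ioc 0 t, ‖(k : ℝ →ₘ[halfLine] ℂ) s‖ : ℝ) : ℂ) := by
    rw [intervalIntegral.integral_of_le ht.le, ← integral_complex_ofReal]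
    exact integral_congr_ae (ae_mono hle hk')
  have e2 : ∫⁻ s in Ioc 0 t, ‖(k : ℝ →ₘ[halfLine] ℂ) s‖ₑ =
      ENNReal.ofReal (∫ s in Ioc 0 t, ‖(k : ℝ →ₘ[halfLine] ℂ) s‖) := by
    rw [ofReal_integral_eq_lintegral_ofReal hkint (Eventually.of_forall fun _ => norm_nonneg _)]
    simp_rw [ofReal_norm]
  rw [h1, e, enorm_mul]
  have e3 : ‖((t : ℂ))⁻¹‖ₑ = (ENNReal.ofReal t)⁻¹ := by
    rw [← ofReal_norm, norm_inv, Complex.norm_real, Real.norm_of_nonneg ht.le,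
      ENNReal.ofReal_inv_of_pos ht]
  have e4 : ‖((∫ s in Ioc 0 t, ‖(k : ℝ →ₘ[halfLine] ℂ) s‖ : ℝ) : ℂ)‖ₑ =
      ∫⁻ s in Ioc 0 t, ‖(k : ℝ →ₘ[halfLine] ℂ) s‖ₑ := by
    rw [e2, ← ofReal_norm, Complex.norm_real,
      Real.norm_of_nonneg (integral_nonneg fun _ => norm_nonneg _)]
  rw [e3, e4, mul_comm, ← div_eq_mul_inv]
  refine ENNReal.div_le_div_right ?_ _
  exact lintegral_mono_ae (ae_mono hle hk)

/-- The function `t ↦ 1 / t` on `[T, ∞)` is dominated by the Hardy transform of a multiple of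
the indicator of `(0, T]`. -/
theorem isMajorized_indicator_inv (hE : E.HardyBounded) {T : ℝ} (hT : 0 < T) :
    E.IsMajorized ((Ici T).indicator fun t => (ENNReal.ofReal t)⁻¹) := by
  have h := ((isMajorized_indicator_const (E := E) 1 (by simp) T).hardy hE).const_mul
    (c := (ENNReal.ofReal T)⁻¹) (by simp [hT])
  refine h.mono ?_
  refine Eventually.of_forall fun t => ?_
  simp only [indicator, mem_Ici]
  split_ifs with ht
  · have : ∫⁻ s in Ioc 0 t, (Iic T).indicator (fun _ => (1 : ℝ≥0∞)) s = ENNReal.ofReal T := by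
      rw [lintegral_indicator measurableSet_Iic, Measure.restrict_restrict measurableSet_Iic]
      have : Iic T ∩ Ioc 0 t = Ioc 0 T := by ext s; simp; grind
      simp [this]
    simp only [indicator] at this
    rw [this, div_eq_mul_inv, ← mul_assoc, ENNReal.inv_mul_cancel (by simp [hT]) (by simp), one_mul]
  · simp

end BanachFunctionSpace

variable {X : Type*} [NormedAddCommGroup X] [NormedSpace ℝ X] {ω : ℝ} {A : Set (X × X)}

/-! ### Resolvents -/

theorem IsAccretive.norm_sub_le (hA : IsAccretive ω A) {u v f g : X} (hu : (u, f) ∈ A)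
    (hv : (v, g) ∈ A) {r : ℝ} (hr : 0 < r) (hrω : r * ω < 1) :
    (1 - r * ω) * ‖u - v‖ ≤ ‖(u + r • f) - (v + r • g)‖ := by
  refine (hA _ hu _ hv r hr hrω).trans_eq ?_
  congr 1
  module

/-- Accretivity with the parameter rs / (r + s), for which the perturbed difference is a convex
combination of the two differences on the right. It compares Euler steps of different sizes and
drives both the Crandall-Liggett recursion and the lower estimate for mild solutions. -/
theorem IsAccretive.norm_sub_le_two_step (hA : IsAccretive ω A) (hω : 0 ≤ ω) {u v f g : X}
    (hu : (u, f) ∈ A) (hv : (v, g) ∈ A) {r s : ℝ} (hr : 0 < r) (hs : 0 < s) (hrω : r * ω < 1) :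
    (r + s - r * s * ω) * ‖u - v‖ ≤ r * ‖u - (v + s • g)‖ + s * ‖u + r • f - v‖ := by
  have hrs : 0 < r + s := by positivity
  have h1 : r * s / (r + s) * ω < 1 := by
    refine lt_of_le_of_lt (mul_le_mul_of_nonneg_right ?_ hω) hrω
    rw [div_le_iff₀ hrs]
    nlinarith
  have h := hA.norm_sub_le hu hv (r := r * s / (r + s)) (by positivity) h1
  have e : (u + (r * s / (r + s)) • f) - (v + (r * s / (r + s)) • g) =
      (r + s)⁻¹ • (r • (u - (v + s • g)) + s • (u + r • f - v)) := by
    match_scalars <;> field_simp <;> ring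
  rw [e, norm_smul, norm_inv, Real.norm_of_nonneg hrs.le] at h
  have h2 : ‖r • (u - (v + s • g)) + s • (u + r • f - v)‖ ≤
      r * ‖u - (v + s • g)‖ + s * ‖u + r • f - v‖ := by
    refine (norm_add_le _ _).trans_eq ?_
    rw [norm_smul, norm_smul, Real.norm_of_nonneg hr.le, Real.norm_of_nonneg hs.le]
  refine le_trans ?_ h2
  have h3 := mul_le_mul_of_nonneg_left h hrs.le
  rw [← mul_assoc, ← mul_assoc, mul_inv_cancel₀ hrs.ne', one_mul] at h3
  refine le_of_eq_of_le ?_ h3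
  field_simp

namespace IsMAccretive

variable {r s t : ℝ} {x y v f : X}

theorem resolv_mem (hA : IsMAccretive ω A) (hr : 0 < r) (hrω : r * ω < 1) (y : X) :
    (resolv A r y, r⁻¹ • (y - resolv A r y)) ∈ A := by
  have h : ∃ v f, (v, f) ∈ A ∧ v + r • f = y := by
    obtain ⟨p, hp, e⟩ := hA.2 r hr hrω y
    exact ⟨p.1, p.2, hp, e⟩
  rw [resolv, dif_pos h]
  obtain ⟨f, hf, e⟩ := h.choose_spec
  have : f = r⁻¹ • (y - h.choose) := by
    rw [eq_inv_smul_iff₀ hr.ne', eq_sub_iff_add_eq', e]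
  rwa [← this]

theorem resolv_add_smul (hr : 0 < r) (y : X) :
    resolv A r y + r • (r⁻¹ • (y - resolv A r y)) = y := by
  rw [smul_inv_smul₀ hr.ne']
  abel

theorem resolv_mem_dom (hA : IsMAccretive ω A) (hr : 0 < r) (hrω : r * ω < 1) (y : X) :
    resolv A r y ∈ dom A := ⟨_, hA.resolv_mem hr hrω y⟩

theorem norm_resolv_sub_le (hA : IsMAccretive ω A) (hr : 0 < r) (hrω : r * ω < 1)
    (x y : X) : (1 - r * ω) * ‖resolv A r x - resolv A r y‖ ≤ ‖x - y‖ := by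
  have h := hA.1.norm_sub_le (hA.resolv_mem hr hrω x) (hA.resolv_mem hr hrω y) hr hrω
  rwa [resolv_add_smul hr, resolv_add_smul hr] at h

theorem norm_sub_resolv_le_of_mem (hA : IsMAccretive ω A) (hr : 0 < r) (hrω : r * ω < 1)
    (hv : (v, f) ∈ A) : (1 - r * ω) * ‖v - resolv A r v‖ ≤ r * ‖f‖ := by
  have h := hA.1.norm_sub_le hv (hA.resolv_mem hr hrω v) hr hrω
  rwa [resolv_add_smul hr, add_sub_cancel_left, norm_smul, Real.norm_of_nonneg hr.le] at h

/-- Insert v and J_r v between x and J_r x: the outer distances are controlled by ‖x - v‖, the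
middle one by r ‖f‖. As (v, f) is arbitrary in the graph, this is the bound by the K-function. -/
theorem norm_sub_resolv_le (hA : IsMAccretive ω A) (hω : 0 ≤ ω) (hr : 0 < r) (hrω : r * ω < 1)
    (hv : (v, f) ∈ A) (x : X) :
    (1 - r * ω) * ‖x - resolv A r x‖ ≤ 2 * (‖x - v‖ + r * ‖f‖) := by
  have h1 := hA.norm_sub_resolv_le_of_mem hr hrω hv
  have h2 := hA.norm_resolv_sub_le hr hrω v x
  have h3 : ‖x - resolv A r x‖ ≤ ‖x - v‖ + ‖v - resolv A r v‖ + ‖resolv A r v - resolv A r x‖ := by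
    refine le_trans (le_of_eq ?_) norm_add₃_le
    congr 1
    abel
  have h4 : (1 - r * ω) * ‖x - v‖ ≤ ‖x - v‖ := by
    have : 0 ≤ r * ω * ‖x - v‖ := by positivity
    linarith
  have h5 := mul_le_mul_of_nonneg_left h3 (sub_nonneg.2 hrω.le)
  rw [norm_sub_rev v x] at h2
  have h6 : 0 ≤ r * ‖f‖ := by positivity
  linarith

/-- Accretivity with parameter s, applied to the graph points of both resolvents: since (x - J_t x)
/ t ∈ A J_t x, the point J_t x solves the s-equation with right-hand side x up to the error (t -
s)(x - J_t x) / t. -/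
theorem norm_resolv_sub_resolv_le (hA : IsMAccretive ω A) (hs : 0 < s) (ht : 0 < t)
    (hsω : s * ω < 1) (htω : t * ω < 1) (x : X) :
    (1 - s * ω) * ‖resolv A t x - resolv A s x‖ ≤ |t - s| * (‖x - resolv A t x‖ / t) := by
  have h := hA.1.norm_sub_le (hA.resolv_mem ht htω x) (hA.resolv_mem hs hsω x) hs hsω
  rw [resolv_add_smul hs] at h
  have e : resolv A t x + s • t⁻¹ • (x - resolv A t x) - x =
      (-((t - s) * t⁻¹)) • (x - resolv A t x) := by
    match_scalars <;> field_simp <;> ring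
  rw [e, norm_smul, norm_neg, norm_mul, norm_inv, Real.norm_of_nonneg ht.le, Real.norm_eq_abs] at h
  exact h.trans_eq (by ring)

/-- Almost monotonicity of q: moving from s to t displaces the resolvent by at most (t - s) q(s) /
(1 - tω), which is added to ‖x - J_s x‖ = s q(s). -/
theorem quotient_le (hA : IsMAccretive ω A) (hω : 0 ≤ ω) (hs : 0 < s) (hst : s ≤ t)
    (htω : t * ω < 1) (x : X) :
    (1 - t * ω) * (‖x - resolv A t x‖ / t) ≤ ‖x - resolv A s x‖ / s := by
  have ht : 0 < t := hs.trans_le hst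
  have hsω : s * ω < 1 := (mul_le_mul_of_nonneg_right hst hω).trans_lt htω
  have h := hA.norm_resolv_sub_resolv_le ht hs htω hsω x
  set φ := ‖x - resolv A s x‖ / s with hφ
  have hφ0 : 0 ≤ φ := by positivity
  have e : ‖x - resolv A s x‖ = s * φ := by rw [hφ]; field_simp
  rw [abs_of_nonpos (by linarith)] at h
  have h3 : ‖x - resolv A t x‖ ≤ ‖x - resolv A s x‖ + ‖resolv A s x - resolv A t x‖ := by
    refine le_trans (le_of_eq ?_) (norm_add_le _ _)
    congr 1
    abel
  have h5 := mul_le_mul_of_nonneg_left h3 (sub_nonneg.2 htω.le)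
  rw [e] at h5
  have h6 : 0 ≤ t * ω * (s * φ) := by positivity
  rw [← mul_div_assoc, div_le_iff₀ ht]
  nlinarith

theorem continuousOn_resolv (hA : IsMAccretive ω A) (x : X) :
    ContinuousOn (fun t => resolv A t x) {t | 0 < t ∧ t * ω < 1} := by
  rintro t ⟨ht, htω⟩
  refine ContinuousAt.continuousWithinAt ?_
  have hc : ContinuousAt (fun s => |t - s| * (‖x - resolv A t x‖ / t) / (1 - s * ω)) t := by
    refine ContinuousAt.div (by fun_prop) (by fun_prop) (sub_pos.2 htω).ne'
  have hev : ∀ᶠ s in 𝓝 t, 0 < s ∧ s * ω < 1 :=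
    (eventually_gt_nhds ht).and ((continuous_id.mul continuous_const).continuousAt.eventually_lt
      continuousAt_const htω)
  rw [ContinuousAt, tendsto_iff_norm_sub_tendsto_zero]
  refine squeeze_zero' (Eventually.of_forall fun _ => norm_nonneg _) ?_
    (hc.tendsto.trans_eq ?_)
  · filter_upwards [hev] with s hs
    rw [norm_sub_rev, le_div_iff₀ (sub_pos.2 hs.2), mul_comm]
    exact hA.norm_resolv_sub_resolv_le hs.1 ht hs.2 htω x
  · simp

theorem tendsto_resolv (hA : IsMAccretive ω A) (hω : 0 ≤ ω) (hx : x ∈ closure (dom A)) :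
    Tendsto (fun t => resolv A t x) (𝓝[>] 0) (𝓝 x) := by
  rw [Metric.tendsto_nhds]
  intro ε hε
  obtain ⟨v, ⟨f, hv⟩, hxv⟩ := Metric.mem_closure_iff.1 hx (ε / 8) (by positivity)
  have h1 : ∀ᶠ t in 𝓝[>] (0 : ℝ), t * ‖f‖ < ε / 8 :=
    nhdsWithin_le_nhds ((continuous_id.mul continuous_const).continuousAt.eventually_lt
      continuousAt_const (by simpa using hε))
  have h2 : ∀ᶠ t in 𝓝[>] (0 : ℝ), t * ω < 1 / 2 :=
    nhdsWithin_le_nhds ((continuous_id.mul continuous_const).continuousAt.eventually_lt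
      continuousAt_const (by simp))
  filter_upwards [h1, h2, self_mem_nhdsWithin] with t h1 h2 (ht : 0 < t)
  have h := hA.norm_sub_resolv_le hω ht (by linarith) hv x
  rw [dist_eq_norm] at hxv
  rw [dist_comm, dist_eq_norm]
  nlinarith [norm_nonneg (x - resolv A t x)]

end IsMAccretive

/-- An interval `(0, τ)` or `(0, ∞)` on which `t * ω` is bounded by `c < 1`. -/
structure IsInitialInterval (ω c : ℝ) (I : Set ℝ) : Prop where
  isOpen : IsOpen I
  nonempty : I.Nonempty
  pos : ∀ t ∈ I, 0 < t
  mem_of_le : ∀ t ∈ I, ∀ s, 0 < s → s ≤ t → s ∈ I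
  mul_le : ∀ t ∈ I, t * ω ≤ c
  lt_one : c < 1

theorem isInitialInterval_Ioo (hω : 0 ≤ ω) {τ : ℝ} (hτ : 0 < τ) (hτω : τ * ω < 1) :
    IsInitialInterval ω (τ * ω) (Ioo 0 τ) where
  isOpen := isOpen_Ioo
  nonempty := nonempty_Ioo.2 hτ
  pos _ ht := ht.1
  mem_of_le _ ht _ hs hst := ⟨hs, hst.trans_lt ht.2⟩
  mul_le _ ht := mul_le_mul_of_nonneg_right ht.2.le hω
  lt_one := hτω

theorem isInitialInterval_Ioi : IsInitialInterval 0 0 (Ioi 0) where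
  isOpen := isOpen_Ioi
  nonempty := nonempty_Ioi
  pos _ ht := ht
  mem_of_le _ _ _ hs _ := hs
  mul_le _ _ := by simp
  lt_one := one_pos

theorem IsInitialInterval.mul_lt_one {c : ℝ} {I : Set ℝ} (hI : IsInitialInterval ω c I) {t : ℝ}
    (ht : t ∈ I) : t * ω < 1 := (hI.mul_le t ht).trans_lt hI.lt_one

/-! ### The K-function -/

theorem kFun_le {v f : X} (hv : (v, f) ∈ A) (x : X) {t : ℝ} (ht : 0 ≤ t) :
    kFun (fun x => ‖x‖ₑ) (setNorm A) x t ≤ ENNReal.ofReal (‖x - v‖ + t * ‖f‖) := by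
  refine (iInf_le _ v).trans ?_
  rw [ENNReal.ofReal_add (norm_nonneg _) (by positivity), ENNReal.ofReal_mul ht, ofReal_norm,
    ofReal_norm]
  gcongr
  exact iInf₂_le f hv

theorem le_kFun {a : ℝ≥0∞} {x : X} {t : ℝ} (ht : 0 < t)
    (h : ∀ v f, (v, f) ∈ A → a ≤ ENNReal.ofReal (‖x - v‖ + t * ‖f‖)) :
    a ≤ kFun (fun x => ‖x‖ₑ) (setNorm A) x t := by
  refine le_iInf fun v => ?_
  by_cases hv : ∃ f, (v, f) ∈ A
  · have h0 : ENNReal.ofReal t ≠ 0 := by simpa using ht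
    simp only [setNorm, ENNReal.mul_iInf_of_ne h0 ENNReal.ofReal_ne_top, ENNReal.add_iInf]
    refine le_iInf₂ fun f hf => ?_
    have := h v f hf
    rwa [ENNReal.ofReal_add (norm_nonneg _) (by positivity), ENNReal.ofReal_mul ht.le, ofReal_norm,
      ofReal_norm] at this
  · push Not at hv
    -- Outside the domain the set norm is ∞; positivity of t excludes the convention 0 * ∞ = 0.
    simp [setNorm, hv, ht]

theorem measurable_kFun (N₀ N₁ : X → ℝ≥0∞) (x : X) : Measurable (kFun N₀ N₁ x) := by
  refine Monotone.measurable fun s t hst => ?_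
  exact iInf_mono fun v => by gcongr

theorem aemeasurable_indicator_kFun {I : Set ℝ} (hI : IsOpen I) (x : X) :
    AEMeasurable (I.indicator fun t =>
      kFun (fun x => ‖x‖ₑ) (setNorm A) x t / ENNReal.ofReal t) halfLine :=
  (((measurable_kFun _ _ x).div ENNReal.measurable_ofReal).indicator hI.measurableSet).aemeasurable

variable {c : ℝ} {I : Set ℝ} {E : BanachFunctionSpace}

theorem mem_kSet_iff (hI : IsOpen I) {x : X} : x ∈ kSet A E I ↔
    E.IsMajorized (I.indicator fun t =>
      kFun (fun x => ‖x‖ₑ) (setNorm A) x t / ENNReal.ofReal t) :=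
  BanachFunctionSpace.memExt_iff.trans (and_iff_right (aemeasurable_indicator_kFun hI x))

theorem effDom_opK (hI : IsOpen I) : effDom (opK A E I) = kSet A E I := by
  ext x
  exact E.extNorm_lt_top_iff (aemeasurable_indicator_kFun hI x)

theorem enorm_indicator_quotient (hI : IsInitialInterval ω c I) (u : ℝ → X) (x : X) (t : ℝ) :
    ‖I.indicator (fun t => ‖x - u t‖ / t) t‖ₑ =
      I.indicator (fun t => ENNReal.ofReal (‖x - u t‖ / t)) t := by
  by_cases ht : t ∈ I
  · simp only [ht, indicator_of_mem]
    exact Real.enorm_of_nonneg (div_nonneg (norm_nonneg _) (hI.pos t ht).le)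
  · simp [ht]

theorem mem_quotient_iff (hI : IsInitialInterval ω c I) {u : ℝ → X} (hu : ContinuousOn u I)
    {x : X} : E.Mem (I.indicator fun t => ‖x - u t‖ / t) ↔
    E.IsMajorized (I.indicator fun t => ENNReal.ofReal (‖x - u t‖ / t)) := by
  have hm : AEMeasurable (I.indicator fun t => ‖x - u t‖ / t) halfLine := by
    have hc : ContinuousOn (fun t => ‖x - u t‖ / t) I :=
      ContinuousOn.div (by fun_prop) continuousOn_id fun t ht => (hI.pos t ht).ne'
    rw [aemeasurable_indicator_iff hI.isOpen.measurableSet]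
    exact (hc.aemeasurable hI.isOpen.measurableSet).mono_measure
      (Measure.restrict_mono_measure Measure.restrict_le_self _)
  rw [BanachFunctionSpace.mem_iff, and_iff_right hm]
  simp_rw [enorm_indicator_quotient hI]

theorem IsMAccretive.continuousOn_resolv_interval (hA : IsMAccretive ω A)
    (hI : IsInitialInterval ω c I) (x : X) : ContinuousOn (fun t => resolv A t x) I :=
  (hA.continuousOn_resolv x).mono fun t ht => ⟨hI.pos t ht, hI.mul_lt_one ht⟩

theorem IsMAccretive.mem_resolvSet_iff (hA : IsMAccretive ω A) (hI : IsInitialInterval ω c I)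
    {x : X} : x ∈ resolvSet A E I ↔
    E.IsMajorized (I.indicator fun t => ENNReal.ofReal (‖x - resolv A t x‖ / t)) :=
  mem_quotient_iff hI (hA.continuousOn_resolv_interval hI x)

theorem IsMAccretive.kFun_le_resolv (hA : IsMAccretive ω A) {t : ℝ} (ht : 0 < t)
    (htω : t * ω < 1) (x : X) :
    kFun (fun x => ‖x‖ₑ) (setNorm A) x t ≤ 2 * ENNReal.ofReal ‖x - resolv A t x‖ := by
  refine (kFun_le (hA.resolv_mem ht htω x) x ht.le).trans_eq ?_
  rw [norm_smul, norm_inv, Real.norm_of_nonneg ht.le, mul_inv_cancel_left₀ ht.ne', ← two_mul,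
    ENNReal.ofReal_mul zero_le_two, ENNReal.ofReal_ofNat]

theorem IsMAccretive.ofReal_norm_sub_resolv_le_kFun (hA : IsMAccretive ω A) (hω : 0 ≤ ω)
    (hI : IsInitialInterval ω c I) {t : ℝ} (ht : t ∈ I) (x : X) :
    ENNReal.ofReal ‖x - resolv A t x‖ ≤
      ENNReal.ofReal (2 / (1 - c)) * kFun (fun x => ‖x‖ₑ) (setNorm A) x t := by
  have hc : 0 < 1 - c := sub_pos.2 hI.lt_one
  have hC : 0 < 2 / (1 - c) := by positivity
  have ht0 := hI.pos t ht
  rw [mul_comm, ← ENNReal.div_le_iff_le_mul (Or.inl (by simpa using hC)) (Or.inl (by simp)),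
    ← ENNReal.ofReal_div_of_pos hC]
  refine le_kFun ht0 fun v f hv => ENNReal.ofReal_le_ofReal ?_
  have h := hA.norm_sub_resolv_le hω ht0 (hI.mul_lt_one ht) hv x
  have h2 : (1 - c) * ‖x - resolv A t x‖ ≤ (1 - t * ω) * ‖x - resolv A t x‖ := by
    gcongr; exact hI.mul_le t ht
  rw [div_le_iff₀ hC, mul_div_assoc', le_div_iff₀ hc]
  linarith

theorem IsMAccretive.resolvSet_eq_kSet (hA : IsMAccretive ω A) (hω : 0 ≤ ω)
    (hI : IsInitialInterval ω c I) : resolvSet A E I = kSet A E I := by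
  ext x
  rw [hA.mem_resolvSet_iff hI, mem_kSet_iff hI.isOpen]
  constructor <;> intro h
  · refine (h.const_mul (c := 2) (by simp)).mono (Eventually.of_forall fun t => ?_)
    by_cases ht : t ∈ I
    · simp only [ht, indicator_of_mem]
      rw [ENNReal.ofReal_div_of_pos (hI.pos t ht), ← mul_div_assoc]
      exact ENNReal.div_le_div_right (hA.kFun_le_resolv (hI.pos t ht) (hI.mul_lt_one ht) x) _
    · simp [ht]
  · refine (h.const_mul (c := ENNReal.ofReal (2 / (1 - c))) (by simp)).mono
      (Eventually.of_forall fun t => ?_)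
    by_cases ht : t ∈ I
    · simp only [ht, indicator_of_mem]
      rw [ENNReal.ofReal_div_of_pos (hI.pos t ht), ← mul_div_assoc]
      exact ENNReal.div_le_div_right (hA.ofReal_norm_sub_resolv_le_kFun hω hI ht x) _
    · simp [ht]

theorem IsMAccretive.dom_subset_resolvSet (hA : IsMAccretive ω A) (hω : 0 ≤ ω) {τ : ℝ}
    (hτ : 0 < τ) (hτω : τ * ω < 1) : dom A ⊆ resolvSet A E (Ioo 0 τ) := by
  rintro v ⟨f, hv⟩
  have hI := isInitialInterval_Ioo hω hτ hτω
  have hc : 0 < 1 - τ * ω := by linarith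
  rw [hA.mem_resolvSet_iff hI]
  refine (BanachFunctionSpace.isMajorized_indicator_const
    (ENNReal.ofReal (‖f‖ / (1 - τ * ω))) (by simp) τ).mono (Eventually.of_forall fun t => ?_)
  by_cases ht : t ∈ Ioo 0 τ
  · have ht' : t ∈ Iic τ := ht.2.le
    simp only [ht, ht', indicator_of_mem]
    refine ENNReal.ofReal_le_ofReal ?_
    have h := hA.norm_sub_resolv_le_of_mem ht.1 (hI.mul_lt_one ht) hv
    have h2 : (1 - τ * ω) * ‖v - resolv A t v‖ ≤ (1 - t * ω) * ‖v - resolv A t v‖ := by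
      gcongr; exact ht.2.le
    rw [div_le_iff₀ ht.1, div_mul_eq_mul_div, le_div_iff₀ hc]
    linarith
  · simp [ht]

/-- If x had distance d > 0 from the domain, then q(t) ≥ d / t because J_t x lies in the domain. But
functions with a majorant in E are integrable near 0, and 1 / t is not. -/
theorem IsMAccretive.resolvSet_subset_closure (hA : IsMAccretive ω A)
    (hI : IsInitialInterval ω c I) : resolvSet A E I ⊆ closure (dom A) := by
  intro x hx
  rw [hA.mem_resolvSet_iff hI] at hx
  by_contra hcl
  obtain ⟨T, hT⟩ := hI.nonempty
  have hT0 := hI.pos T hT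
  have hne : (dom A).Nonempty := ⟨_, hA.resolv_mem_dom hT0 (hI.mul_lt_one hT) x⟩
  have hd : 0 < Metric.infDist x (dom A) := by
    rw [← Metric.infDist_closure]
    exact (isClosed_closure.notMem_iff_infDist_pos hne.closure).1 hcl
  have hfin := hx.lintegral_lt_top T
  have hle : ∫⁻ t in Ioc 0 T, ENNReal.ofReal (Metric.infDist x (dom A)) * ‖t⁻¹‖ₑ ≤
      ∫⁻ t in Ioc 0 T, I.indicator (fun t => ENNReal.ofReal (‖x - resolv A t x‖ / t)) t := by
    refine setLIntegral_mono' measurableSet_Ioc fun t ht => ?_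
    have htI := hI.mem_of_le T hT t ht.1 ht.2
    rw [indicator_of_mem htI, Real.enorm_of_nonneg (inv_nonneg.2 ht.1.le),
      ← ENNReal.ofReal_mul hd.le, ← div_eq_mul_inv]
    refine ENNReal.ofReal_le_ofReal (div_le_div_of_nonneg_right ?_ ht.1.le)
    rw [← dist_eq_norm]
    exact Metric.infDist_le_dist_of_mem (hA.resolv_mem_dom ht.1 (hI.mul_lt_one htI) x)
  rw [lintegral_const_mul' _ _ ENNReal.ofReal_ne_top] at hle
  have h2 : ∫⁻ t in Ioc 0 T, ‖(t⁻¹ : ℝ)‖ₑ < ⊤ := by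
    have := (hle.trans_lt hfin)
    by_contra hcon
    rw [not_lt_top_iff] at hcon
    rw [hcon, ENNReal.mul_top (by simpa using hd)] at this
    exact lt_irrefl _ this
  have h3 : IntervalIntegrable (fun t : ℝ => t⁻¹) volume 0 T := by
    rw [intervalIntegrable_iff_integrableOn_Ioc_of_le hT0.le]
    exact ⟨measurable_inv.aestronglyMeasurable, h2⟩
  rw [intervalIntegrable_inv_iff] at h3
  rcases h3 with h3 | h3
  · exact hT0.ne h3
  · exact h3 left_mem_uIcc

/-! ### The resolvent curve and the mean method -/

theorem resolvCurve_zero (A : Set (X × X)) (x : X) : resolvCurve A x 0 = x := by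
  simp [resolvCurve]

theorem resolvCurve_of_pos (A : Set (X × X)) (x : X) {t : ℝ} (ht : 0 < t) :
    resolvCurve A x t = resolv A t x := by
  simp [resolvCurve, ht]

theorem IsMAccretive.continuousOn_resolvCurve (hA : IsMAccretive ω A) (hω : 0 ≤ ω) {x : X}
    (hx : x ∈ closure (dom A)) :
    ContinuousOn (resolvCurve A x) {t | 0 ≤ t ∧ t * ω < 1} := by
  rintro t ⟨ht, htω⟩
  rcases ht.eq_or_lt with rfl | ht
  · have h : ContinuousWithinAt (resolvCurve A x) (Ioi 0) 0 := by
      rw [ContinuousWithinAt, resolvCurve_zero]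
      refine (hA.tendsto_resolv hω hx).congr' ?_
      filter_upwards [self_mem_nhdsWithin] with t ht
      exact (resolvCurve_of_pos A x ht).symm
    rw [← continuousWithinAt_insert_self, Ioi_insert] at h
    exact h.mono fun t ht => ht.1
  · have h : ContinuousAt (fun t => resolv A t x) t := by
      refine (hA.continuousOn_resolv x).continuousAt ?_
      refine (IsOpen.inter isOpen_Ioi ?_).mem_nhds ⟨ht, htω⟩
      exact isOpen_lt (continuous_id.mul continuous_const) continuous_const
    refine (h.congr ?_).continuousWithinAt
    filter_upwards [lt_mem_nhds ht] with s hs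
    exact (resolvCurve_of_pos A x hs).symm

theorem IsMAccretive.setNorm_resolv_le (hA : IsMAccretive ω A) {t : ℝ} (ht : 0 < t)
    (htω : t * ω < 1) (x : X) :
    setNorm A (resolv A t x) ≤ ENNReal.ofReal (‖x - resolv A t x‖ / t) := by
  refine (iInf₂_le (f := fun (f : X) (_ : (_, f) ∈ A) => ‖f‖ₑ) _ (hA.resolv_mem ht htω x)).trans_eq ?_
  rw [← ofReal_norm, norm_smul, norm_inv, Real.norm_of_nonneg ht.le, inv_mul_eq_div]

theorem mem_effDom_opMean_iff {G : Set (ℝ → X)} {x : X} : x ∈ effDom (opMean A E G I) ↔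
    ∃ u ∈ G, E.IsMajorized (I.indicator fun t => ‖x - u t‖ₑ / ENNReal.ofReal t) ∧
      E.IsMajorized (I.indicator fun t => setNorm A (u t)) := by
  simp only [effDom, opMean, meanMethod, mem_ofPred_eq, iInf_lt_iff, ENNReal.add_lt_top,
    BanachFunctionSpace.extNorm_lt_top_iff_isMajorized, exists_prop]

theorem effDom_opMean_subset_kSet (hI : IsInitialInterval ω c I) (G : Set (ℝ → X)) :
    effDom (opMean A E G I) ⊆ kSet A E I := by
  intro x hx
  obtain ⟨u, -, h0, h1⟩ := mem_effDom_opMean_iff.1 hx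
  rw [mem_kSet_iff hI.isOpen]
  refine (h0.add h1).mono (Eventually.of_forall fun t => ?_)
  by_cases ht : t ∈ I
  · have ht0 := hI.pos t ht
    simp only [ht, indicator_of_mem]
    rw [ENNReal.div_le_iff (by simpa using ht0) (by simp), add_mul,
      ENNReal.div_mul_cancel (by simpa using ht0) (by simp), mul_comm]
    refine (iInf_le _ (u t)).trans ?_
    rw [mul_comm]
  · simp [ht]

theorem continuousFunctions_subset_measurableFunctions :
    continuousFunctions X ⊆ measurableFunctions X := fun _ hu =>
  (ContinuousOn.mono hu Ioi_subset_Ici_self).aestronglyMeasurable measurableSet_Ioi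

theorem IsMAccretive.resolvSet_subset_effDom_opMean (hA : IsMAccretive ω A) (hω : 0 ≤ ω) {τ : ℝ}
    (hτ : 0 < τ) (hτω : τ * ω < 1) {G : Set (ℝ → X)} (hG : continuousFunctions X ⊆ G) :
    resolvSet A E (Ioo 0 τ) ⊆ effDom (opMean A E G (Ioo 0 τ)) := by
  intro x hx
  have hI := isInitialInterval_Ioo hω hτ hτω
  have hcl := hA.resolvSet_subset_closure hI hx
  rw [hA.mem_resolvSet_iff hI] at hx
  rw [mem_effDom_opMean_iff]
  have e : ∀ t ∈ Ioo 0 τ, resolvCurve A x (min t τ) = resolv A t x := fun t ht => by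
    rw [min_eq_left ht.2.le, resolvCurve_of_pos A x ht.1]
  -- The competitor must be continuous on all of [0, ∞), while resolvents are only controlled for tω
  -- < 1; so the curve is frozen at time τ.
  refine ⟨fun t => resolvCurve A x (min t τ), hG ?_, hx.mono (Eventually.of_forall fun t => ?_),
    hx.mono (Eventually.of_forall fun t => ?_)⟩
  · refine (hA.continuousOn_resolvCurve hω hcl).comp (by fun_prop) fun t ht => ?_
    exact ⟨le_min ht hτ.le, (mul_le_mul_of_nonneg_right (min_le_right _ _) hω).trans_lt hτω⟩
  · by_cases ht : t ∈ Ioo 0 τ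
    · simp only [ht, indicator_of_mem, e t ht]
      rw [ENNReal.ofReal_div_of_pos ht.1, ofReal_norm]
    · simp [ht]
  · by_cases ht : t ∈ Ioo 0 τ
    · simp only [ht, indicator_of_mem, e t ht]
      exact hA.setNorm_resolv_le ht.1 (hI.mul_lt_one ht) x
    · simp [ht]

theorem IsMAccretive.resolvSet_eq_effDom_opMean (hA : IsMAccretive ω A) (hω : 0 ≤ ω) {τ : ℝ}
    (hτ : 0 < τ) (hτω : τ * ω < 1) {G : Set (ℝ → X)} (hG : continuousFunctions X ⊆ G) :
    resolvSet A E (Ioo 0 τ) = effDom (opMean A E G (Ioo 0 τ)) :=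
  (hA.resolvSet_subset_effDom_opMean hω hτ hτω hG).antisymm
    ((effDom_opMean_subset_kSet (isInitialInterval_Ioo hω hτ hτω) G).trans_eq
      (hA.resolvSet_eq_kSet hω (isInitialInterval_Ioo hω hτ hτω)).symm)

/-! ### The operator `I + hA` -/

theorem mk_mem_idAdd {h : ℝ} {v w : X} :
    (v, w) ∈ idAdd h A ↔ ∃ f, (v, f) ∈ A ∧ w = v + h • f := Iff.rfl

/-- The identity I + r(I + hA) = (1 + r)(I + (rh / (1 + r)) A) reduces everything to A. The
parameter rh / (1 + r) stays below h, hence admissible for every r > 0, and hω < 1 makes the type 0.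
-/
theorem IsMAccretive.idAdd (hA : IsMAccretive ω A) (hω : 0 ≤ ω) {h : ℝ} (hh : 0 < h)
    (hhω : h * ω < 1) : IsMAccretive 0 (idAdd h A) := by
  have key : ∀ r : ℝ, 0 < r → 0 < r * h / (1 + r) ∧ r * h / (1 + r) * ω < 1 := fun r hr => by
    refine ⟨by positivity, lt_of_le_of_lt (mul_le_mul_of_nonneg_right ?_ hω) hhω⟩
    rw [div_le_iff₀ (by positivity)]
    nlinarith
  constructor
  · rintro ⟨u, u'⟩ hu ⟨v, v'⟩ hv r hr -
    obtain ⟨f, hf, rfl⟩ := mk_mem_idAdd.1 hu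
    obtain ⟨g, hg, rfl⟩ := mk_mem_idAdd.1 hv
    have hA' := hA.1.norm_sub_le hf hg (key r hr).1 (key r hr).2
    have h1 : 0 < 1 + r := by positivity
    have e : u - v + r • (u + h • f - (v + h • g)) =
        (1 + r) • ((u + (r * h / (1 + r)) • f) - (v + (r * h / (1 + r)) • g)) := by
      match_scalars <;> field_simp <;> ring
    simp only at hA' ⊢
    rw [e, norm_smul, Real.norm_of_nonneg h1.le]
    refine le_trans ?_ (mul_le_mul_of_nonneg_left hA' h1.le)
    rw [← mul_assoc]
    refine mul_le_mul_of_nonneg_right ?_ (norm_nonneg _)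
    have e2 : (1 + r) * (1 - r * h / (1 + r) * ω) = 1 + r * (1 - h * ω) := by field_simp; ring
    rw [e2]
    nlinarith
  · intro r hr _ y
    obtain ⟨p, hp, e⟩ := hA.2 _ (key r hr).1 (key r hr).2 ((1 + r)⁻¹ • y)
    refine ⟨(p.1, p.1 + h • p.2), ⟨p.2, hp, rfl⟩, ?_⟩
    have h1 : 1 + r ≠ 0 := by positivity
    rw [eq_inv_smul_iff₀ h1] at e
    rw [← e]
    match_scalars <;> field_simp

/-- The zero is J_h 0. -/
theorem IsMAccretive.exists_zero_idAdd (hA : IsMAccretive ω A) {h : ℝ} (hh : 0 < h)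
    (hhω : h * ω < 1) : ∃ v, (v, (0 : X)) ∈ AccretiveInterpolation.idAdd h A := by
  obtain ⟨p, hp, e⟩ := hA.2 h hh hhω 0
  exact ⟨p.1, p.2, hp, e.symm⟩

theorem le_mul_kFun_add {a : ℝ≥0∞} {x : X} {t C b : ℝ} (ht : 0 < t) (hC : 0 < C) (hb : 0 ≤ b)
    (h : ∀ v f, (v, f) ∈ A → a ≤ ENNReal.ofReal (C * (‖x - v‖ + t * ‖f‖) + b)) :
    a ≤ ENNReal.ofReal C * kFun (fun x => ‖x‖ₑ) (setNorm A) x t + ENNReal.ofReal b := by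
  rw [← tsub_le_iff_right, mul_comm, ← ENNReal.div_le_iff_le_mul (Or.inl (by simpa using hC))
    (Or.inl (by simp))]
  refine le_kFun ht fun v f hv => ?_
  rw [ENNReal.div_le_iff_le_mul (Or.inl (by simpa using hC)) (Or.inl (by simp)),
    tsub_le_iff_right, ← ENNReal.ofReal_mul (by positivity), ← ENNReal.ofReal_add (by positivity) hb,
    mul_comm]
  exact h v f hv

theorem mem_kSet_of_kFun_le {B : Set (X × X)} {x : X} {τ C b : ℝ}
    (h : ∀ t ∈ Ioo 0 τ, kFun (fun x => ‖x‖ₑ) (setNorm B) x t ≤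
      ENNReal.ofReal C * kFun (fun x => ‖x‖ₑ) (setNorm A) x t + ENNReal.ofReal (t * b))
    (hx : x ∈ kSet A E (Ioo 0 τ)) : x ∈ kSet B E (Ioo 0 τ) := by
  rw [mem_kSet_iff isOpen_Ioo] at hx ⊢
  refine ((hx.const_mul (c := ENNReal.ofReal C) (by simp)).add
    (BanachFunctionSpace.isMajorized_indicator_const (ENNReal.ofReal b) (by simp) τ)).mono
    (Eventually.of_forall fun t => ?_)
  by_cases ht : t ∈ Ioo 0 τ
  · have ht' : t ∈ Iic τ := ht.2.le
    have h0 : ENNReal.ofReal t ≠ 0 := by simpa using ht.1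
    simp only [ht, ht', indicator_of_mem]
    refine (ENNReal.div_le_div_right (h t ht) _).trans_eq ?_
    rw [ENNReal.add_div, mul_div_assoc, ENNReal.ofReal_mul ht.1.le,
      ENNReal.mul_div_right_comm, ENNReal.div_self h0 (by simp), one_mul]
  · simp [ht]

/-- Writing v = x - (x - v), the norms of v + hf and hf differ by at most ‖x‖ + ‖x - v‖. After
multiplication by t < τ the second term is absorbed into the constant, and the first is an error t
‖x‖, or t ‖x‖ / h in the other direction. -/
theorem kSet_idAdd {h τ : ℝ} (hh : 0 < h) (hτ : 0 < τ) :
    kSet A E (Ioo 0 τ) = kSet (idAdd h A) E (Ioo 0 τ) := by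
  ext x
  constructor
  · refine mem_kSet_of_kFun_le (C := 1 + τ + h) (b := ‖x‖) fun t ht =>
      le_mul_kFun_add ht.1 (by positivity) (by have := ht.1; positivity) fun v f hv => ?_
    refine (kFun_le (A := idAdd h A) (mk_mem_idAdd.2 ⟨f, hv, rfl⟩) x ht.1.le).trans
      (ENNReal.ofReal_le_ofReal ?_)
    have h1 : ‖v + h • f‖ ≤ ‖x‖ + ‖x - v‖ + h * ‖f‖ := by
      have e : v + h • f = x - (x - v) + h • f := by abel
      rw [e]
      refine (norm_add_le _ _).trans (add_le_add (norm_sub_le _ _) ?_)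
      rw [norm_smul, Real.norm_of_nonneg hh.le]
    have h2 := mul_le_mul_of_nonneg_left h1 ht.1.le
    have h3 : t * ‖x - v‖ ≤ τ * ‖x - v‖ := by gcongr; exact ht.2.le
    have h4 : 0 ≤ t * ‖f‖ := mul_nonneg ht.1.le (norm_nonneg _)
    have h5 : 0 ≤ τ * (t * ‖f‖) := by positivity
    have h6 : 0 ≤ h * ‖x - v‖ := by positivity
    nlinarith
  · refine mem_kSet_of_kFun_le (C := 1 + τ / h + 1 / h) (b := ‖x‖ / h) fun t ht =>
      le_mul_kFun_add ht.1 (by positivity) (by have := ht.1; positivity) ?_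
    intro v w hw
    obtain ⟨f, hv, rfl⟩ := mk_mem_idAdd.1 hw
    refine (kFun_le hv x ht.1.le).trans (ENNReal.ofReal_le_ofReal ?_)
    have h1 : h * ‖f‖ ≤ ‖v + h • f‖ + ‖x‖ + ‖x - v‖ := by
      have e : h • f = (v + h • f) - (x - (x - v)) := by abel
      rw [← Real.norm_of_nonneg hh.le, ← norm_smul, Real.norm_of_nonneg hh.le]
      conv_lhs => rw [e]
      exact (norm_sub_le _ _).trans (by linarith [norm_sub_le x (x - v)])
    have h1' : ‖f‖ ≤ (‖v + h • f‖ + ‖x‖ + ‖x - v‖) / h := by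
      rw [le_div_iff₀ hh]; linarith
    have h2 := mul_le_mul_of_nonneg_left h1' ht.1.le
    have h3 : t * ‖x - v‖ ≤ τ * ‖x - v‖ := by gcongr; exact ht.2.le
    have h4 : 0 ≤ t * ‖v + h • f‖ := mul_nonneg ht.1.le (norm_nonneg _)
    have h5 : 0 ≤ τ / h * (t * ‖v + h • f‖) := by positivity
    have h6 : 0 ≤ ‖x - v‖ / h := by positivity
    have h7 : t * ‖x - v‖ / h ≤ τ * ‖x - v‖ / h := by gcongr
    have e1 : t * ((‖v + h • f‖ + ‖x‖ + ‖x - v‖) / h) =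
      t * ‖v + h • f‖ / h + t * (‖x‖ / h) + t * ‖x - v‖ / h := by ring
    have e2 : (1 + τ / h + 1 / h) * (‖x - v‖ + t * ‖v + h • f‖) =
      ‖x - v‖ + t * ‖v + h • f‖ + τ * ‖x - v‖ / h + τ / h * (t * ‖v + h • f‖) + ‖x - v‖ / h
        + t * ‖v + h • f‖ / h := by ring
    linarith

/-- Testing the infimum with the zero v gives K(x, t) ≤ ‖x - v‖ for all t, so beyond τ the quotient
K / t is at most a multiple of 1 / t. -/
theorem kSet_Ioi_eq_of_zero (hE : E.HardyBounded) {v : X} (hv : (v, (0 : X)) ∈ A) {τ : ℝ}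
    (hτ : 0 < τ) : kSet A E (Ioo 0 τ) = kSet A E (Ioi 0) := by
  ext x
  rw [mem_kSet_iff isOpen_Ioo, mem_kSet_iff isOpen_Ioi]
  constructor <;> intro hx
  · refine (hx.add ((BanachFunctionSpace.isMajorized_indicator_inv hE hτ).const_mul
      (c := ‖x - v‖ₑ) (by simp))).mono (Eventually.of_forall fun t => ?_)
    by_cases ht : 0 < t
    · rw [indicator_of_mem (show t ∈ Ioi 0 from ht)]
      by_cases htτ : t < τ
      · rw [indicator_of_mem (show t ∈ Ioo 0 τ from ⟨ht, htτ⟩)]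
        exact le_self_add
      · rw [indicator_of_mem (show t ∈ Ici τ from not_lt.1 htτ), ← div_eq_mul_inv]
        refine le_trans (ENNReal.div_le_div_right ?_ _) le_add_self
        refine (kFun_le hv x ht.le).trans_eq ?_
        simp [ofReal_norm]
    · simp [ht]
  · refine hx.mono (Eventually.of_forall fun t => ?_)
    exact indicator_le_indicator_of_subset Ioo_subset_Ioi_self (fun _ => zero_le) t

/-! ### The variation of the resolvent curve -/

/-- Used with G a multiple of the primitive of q, which carries the absolute continuity over to the
resolvent curve. -/
theorem absolutelyContinuousOnInterval_of_dist_le {f : ℝ → X} {G : ℝ → ℝ} {a b : ℝ}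
    (hG : AbsolutelyContinuousOnInterval G a b)
    (h : ∀ s ∈ uIcc a b, ∀ t ∈ uIcc a b, dist (f s) (f t) ≤ dist (G s) (G t)) :
    AbsolutelyContinuousOnInterval f a b := by
  rw [absolutelyContinuousOnInterval_iff] at hG ⊢
  intro ε hε
  obtain ⟨δ, hδ, H⟩ := hG ε hε
  exact ⟨δ, hδ, fun J hJ hJδ => (Finset.sum_le_sum fun i hi =>
    h _ (hJ.1 i hi).1 _ (hJ.1 i hi).2).trans_lt (H J hJ hJδ)⟩

theorem eVariationOn_Icc_le {f : ℝ → X} {G : ℝ → ℝ} {a b : ℝ} (hab : a ≤ b)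
    (h : ∀ s t, a ≤ s → s ≤ t → t ≤ b → ‖f t - f s‖ ≤ G t - G s) :
    eVariationOn f (Icc a b) ≤ ENNReal.ofReal (G b - G a) := by
  have hG : MonotoneOn G (Icc a b) := fun s hs t ht hst =>
    sub_nonneg.1 ((norm_nonneg _).trans (h s t hs.1 hst ht.2))
  have h2 := (hG.eVariationOn_eq (left_mem_Icc.2 hab) (right_mem_Icc.2 hab)).le
  rw [inter_self] at h2
  refine le_trans (iSup_le fun p => ?_) h2
  refine le_trans (Finset.sum_le_sum fun i _ => ?_)
    (eVariationOn.sum_le (n := p.1) p.2.2.1 p.2.2.2)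
  have hs := p.2.2.2 i
  have ht := p.2.2.2 (i + 1)
  have hst := p.2.2.1 (Nat.le_succ i)
  rw [edist_dist, edist_dist, dist_eq_norm, Real.dist_eq]
  exact ENNReal.ofReal_le_ofReal ((h _ _ hs.1 hst ht.2).trans (le_abs_self _))

theorem variation_add {f : ℝ → X} {s t : ℝ} (hs : 0 ≤ s) (hst : s ≤ t) :
    variation f s + eVariationOn f (Icc s t) = variation f t := by
  simpa [variation] using eVariationOn.Icc_add_Icc f hs hst (mem_univ s)

theorem variation_mono (f : ℝ → X) : Monotone (variation f) := fun _ _ h =>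
  eVariationOn.mono f (Icc_subset_Icc_right h)

theorem toReal_variation_sub {f : ℝ → X} {s t : ℝ} (hs : 0 ≤ s) (hst : s ≤ t)
    (ht : variation f t < ⊤) :
    (variation f t).toReal - (variation f s).toReal = (eVariationOn f (Icc s t)).toReal := by
  have h := variation_add (f := f) hs hst
  have h1 : variation f s ≠ ⊤ := ((variation_mono f hst).trans_lt ht).ne
  have h2 : eVariationOn f (Icc s t) ≠ ⊤ := fun e => by simp [e] at h; exact ht.ne h.symm
  rw [← h, ENNReal.toReal_add h1 h2]
  ring

namespace IsMAccretive

variable {a s t T : ℝ} {x : X}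

theorem norm_resolv_sub_resolv_le_mul (hA : IsMAccretive ω A) (hω : 0 ≤ ω) (hc : c < 1)
    (hs : 0 < s) (hst : s ≤ t) (ht : t * ω ≤ c) (x : X) :
    (1 - c) * ‖resolv A t x - resolv A s x‖ ≤ (t - s) * (‖x - resolv A t x‖ / t) := by
  have hsω : s * ω ≤ c := (mul_le_mul_of_nonneg_right hst hω).trans ht
  have h := hA.norm_resolv_sub_resolv_le hs (hs.trans_le hst) (hsω.trans_lt hc) (ht.trans_lt hc) x
  rw [abs_of_nonneg (sub_nonneg.2 hst)] at h
  exact (mul_le_mul_of_nonneg_right (by linarith) (norm_nonneg _)).trans h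

theorem quotient_le_mul (hA : IsMAccretive ω A) (hω : 0 ≤ ω) (hc : c < 1)
    (hs : 0 < s) (hst : s ≤ t) (ht : t * ω ≤ c) (x : X) :
    (1 - c) * (‖x - resolv A t x‖ / t) ≤ ‖x - resolv A s x‖ / s := by
  have := hs.trans_le hst
  exact (mul_le_mul_of_nonneg_right (by linarith) (by positivity)).trans
    (hA.quotient_le hω hs hst (ht.trans_lt hc) x)

theorem norm_resolvCurve_sub_le_of_le (hA : IsMAccretive ω A) (hω : 0 ≤ ω) (hc : c < 1)
    (ha : 0 < a) (has : a ≤ s) (hst : s ≤ t) (ht : t * ω ≤ c) (x : X) :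
    ‖resolvCurve A x t - resolvCurve A x s‖ ≤
      ‖x - resolv A a x‖ / a / (1 - c) ^ 2 * (t - s) := by
  have hs := ha.trans_le has
  rw [resolvCurve_of_pos A x hs, resolvCurve_of_pos A x (hs.trans_le hst)]
  have h1 := hA.norm_resolv_sub_resolv_le_mul hω hc hs hst ht x
  have h2 := hA.quotient_le_mul hω hc ha (has.trans hst) ht x
  have hc' : 0 < 1 - c := by linarith
  rw [div_mul_eq_mul_div, le_div_iff₀ (by positivity)]
  have h3 := mul_le_mul_of_nonneg_left h2 (sub_nonneg.2 hst)
  have h4 := mul_le_mul_of_nonneg_left h1 hc'.le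
  nlinarith

/-- For s > 0 the increment is at most (t - s) q(t) / (1 - c), and almost monotonicity bounds q(t)
by q(r) / (1 - c) for every r in [s, t]; integrate in r. The case s = 0 is the limit, using J_a x →
x on the closure of the domain. -/
theorem norm_resolvCurve_sub_le_integral (hA : IsMAccretive ω A) (hω : 0 ≤ ω) (hc : c < 1)
    (hx : x ∈ closure (dom A)) (hT : T * ω ≤ c)
    (hint : IntegrableOn (fun t => ‖x - resolv A t x‖ / t) (Ioc 0 T)) (hs : 0 ≤ s) (hst : s ≤ t)
    (ht : t ≤ T) :
    (1 - c) ^ 2 * ‖resolvCurve A x t - resolvCurve A x s‖ ≤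
      ∫ r in s..t, ‖x - resolv A r x‖ / r := by
  have hc' : 0 < 1 - c := by linarith
  have htc : t * ω ≤ c := (mul_le_mul_of_nonneg_right ht hω).trans hT
  have hii : ∀ a b, 0 ≤ a → a ≤ b → b ≤ T →
      IntervalIntegrable (fun t => ‖x - resolv A t x‖ / t) volume a b := fun a b ha hab hb => by
    rw [intervalIntegrable_iff_integrableOn_Ioc_of_le hab]
    exact hint.mono_set (Ioc_subset_Ioc ha hb)
  have pos_case : ∀ a, 0 < a → a ≤ t → (1 - c) ^ 2 * ‖resolvCurve A x t - resolvCurve A x a‖ ≤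
      ∫ r in a..t, ‖x - resolv A r x‖ / r := fun a ha hat => by
    rw [resolvCurve_of_pos A x ha, resolvCurve_of_pos A x (ha.trans_le hat)]
    have h1 := mul_le_mul_of_nonneg_left (hA.norm_resolv_sub_resolv_le_mul hω hc ha hat htc x)
      hc'.le
    have h2 : ∫ r in a..t, (1 - c) * (‖x - resolv A t x‖ / t) ≤
        ∫ r in a..t, ‖x - resolv A r x‖ / r := by
      refine intervalIntegral.integral_mono_on hat (by simp) (hii a t ha.le hat ht) fun r hr => ?_
      exact hA.quotient_le_mul hω hc (ha.trans_le hr.1) hr.2 htc x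
    rw [intervalIntegral.integral_const, smul_eq_mul] at h2
    nlinarith
  rcases hs.eq_or_lt with rfl | hs
  · rcases hst.eq_or_lt with rfl | hst'
    · simp
    have hcont0 : Tendsto (resolvCurve A x) (𝓝[>] 0) (𝓝 (resolvCurve A x 0)) := by
      have := (hA.tendsto_resolv hω hx)
      rw [resolvCurve_zero]
      refine this.congr' ?_
      filter_upwards [self_mem_nhdsWithin] with r hr
      exact (resolvCurve_of_pos A x hr).symm
    have hG : ContinuousOn (fun a => ∫ r in t..a, ‖x - resolv A r x‖ / r) (uIcc 0 t) :=
      intervalIntegral.continuousOn_primitive_interval' (hii 0 t le_rfl hst ht) right_mem_uIcc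
    have hG0 : Tendsto (fun a => ∫ r in a..t, ‖x - resolv A r x‖ / r) (𝓝[>] 0)
        (𝓝 (∫ r in (0 : ℝ)..t, ‖x - resolv A r x‖ / r)) := by
      have h1 : ContinuousWithinAt (fun a => ∫ r in a..t, ‖x - resolv A r x‖ / r) (Icc 0 t) 0 := by
        simp_rw [intervalIntegral.integral_symm t, ← uIcc_of_le hst]
        exact (hG 0 left_mem_uIcc).neg
      refine h1.tendsto.mono_left (nhdsWithin_le_of_mem ?_)
      exact mem_of_superset (Ioo_mem_nhdsGT hst') Ioo_subset_Icc_self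
    refine le_of_tendsto_of_tendsto (((hcont0.const_sub _).norm).const_mul _) hG0 ?_
    filter_upwards [Ioo_mem_nhdsGT hst'] with a ha
    exact pos_case a ha.1 ha.2.le
  · exact pos_case s hs hst

theorem integrableOn_quotient (hA : IsMAccretive ω A) (hI : IsInitialInterval ω c I)
    (hx : x ∈ resolvSet A E I) (hT : Ioo 0 T ⊆ I) :
    IntegrableOn (fun t => ‖x - resolv A t x‖ / t) (Ioc 0 T) := by
  rw [integrableOn_Ioc_iff_integrableOn_Ioo]
  rw [hA.mem_resolvSet_iff hI] at hx
  constructor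
  · have hc : ContinuousOn (fun t => ‖x - resolv A t x‖ / t) (Ioo 0 T) := by
      have := (hA.continuousOn_resolv_interval hI x).mono hT
      exact ContinuousOn.div (by fun_prop) continuousOn_id fun t ht => ht.1.ne'
    exact hc.aestronglyMeasurable measurableSet_Ioo
  · refine lt_of_le_of_lt ?_ (hx.lintegral_lt_top T)
    refine le_trans ?_ (lintegral_mono_set Ioo_subset_Ioc_self)
    refine setLIntegral_mono' measurableSet_Ioo fun t ht => ?_
    rw [indicator_of_mem (hT ht), Real.enorm_of_nonneg (div_nonneg (norm_nonneg _) ht.1.le)]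

theorem absolutelyContinuousOnInterval_resolvCurve (hA : IsMAccretive ω A) (hω : 0 ≤ ω)
    (hc : c < 1) (hx : x ∈ closure (dom A)) (hT0 : 0 ≤ T) (hT : T * ω ≤ c)
    (hint : IntegrableOn (fun t => ‖x - resolv A t x‖ / t) (Ioc 0 T)) :
    AbsolutelyContinuousOnInterval (resolvCurve A x) 0 T := by
  have hc' : 0 < 1 - c := by linarith
  have hii : IntervalIntegrable (fun t => ‖x - resolv A t x‖ / t) volume 0 T := by
    rwa [intervalIntegrable_iff_integrableOn_Ioc_of_le hT0]
  refine absolutelyContinuousOnInterval_of_dist_le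
    ((hii.absolutelyContinuousOnInterval_intervalIntegral left_mem_uIcc).const_mul
      ((1 - c) ^ 2)⁻¹) ?_
  have key : ∀ s t, 0 ≤ s → s ≤ t → t ≤ T → dist (resolvCurve A x s) (resolvCurve A x t) ≤
      dist (((1 - c) ^ 2)⁻¹ * ∫ r in (0 : ℝ)..s, ‖x - resolv A r x‖ / r)
        (((1 - c) ^ 2)⁻¹ * ∫ r in (0 : ℝ)..t, ‖x - resolv A r x‖ / r) := fun s t hs hst ht => by
    have h := hA.norm_resolvCurve_sub_le_integral hω hc hx hT hint hs hst ht
    have i1 : IntervalIntegrable (fun t => ‖x - resolv A t x‖ / t) volume 0 s :=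
      hii.mono_set (by rw [uIcc_of_le hs, uIcc_of_le hT0]; exact Icc_subset_Icc le_rfl (hst.trans ht))
    have i2 : IntervalIntegrable (fun t => ‖x - resolv A t x‖ / t) volume s t :=
      hii.mono_set (by rw [uIcc_of_le hst, uIcc_of_le hT0]; exact Icc_subset_Icc hs ht)
    rw [dist_comm, dist_comm (_ * _), dist_eq_norm, Real.dist_eq, ← mul_sub,
      ← intervalIntegral.integral_add_adjacent_intervals i1 i2, add_sub_cancel_left]
    refine le_trans ?_ (le_abs_self _)
    rwa [inv_mul_eq_div, le_div_iff₀ (by positivity), mul_comm]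
  intro s hs t ht
  rw [uIcc_of_le hT0] at hs ht
  rcases le_total s t with h | h
  · exact key s t hs.1 h ht.2
  · rw [dist_comm, dist_comm (_ * _)]
    exact key t s ht.1 h hs.2

theorem eVariationOn_resolvCurve_le (hA : IsMAccretive ω A) (hω : 0 ≤ ω) (hc : c < 1)
    (ha : 0 < a) (has : a ≤ s) (hst : s ≤ t) (ht : t * ω ≤ c) (x : X) :
    eVariationOn (resolvCurve A x) (Icc s t) ≤
      ENNReal.ofReal (‖x - resolv A a x‖ / a / (1 - c) ^ 2 * (t - s)) := by
  rw [mul_sub]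
  refine eVariationOn_Icc_le (G := fun r => ‖x - resolv A a x‖ / a / (1 - c) ^ 2 * r) hst
    fun r r' hr hrr' hr' => ?_
  rw [← mul_sub]
  exact hA.norm_resolvCurve_sub_le_of_le hω hc ha (has.trans hr) hrr'
    ((mul_le_mul_of_nonneg_right hr' hω).trans ht) x

theorem abs_toReal_variation_sub_le (hA : IsMAccretive ω A) (hω : 0 ≤ ω) (hc : c < 1)
    (ha : 0 < a) (hT : T * ω ≤ c) (hfin : variation (resolvCurve A x) T < ⊤)
    (hs : s ∈ Icc a T) (ht : t ∈ Icc a T) :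
    |(variation (resolvCurve A x) s).toReal - (variation (resolvCurve A x) t).toReal| ≤
      ‖x - resolv A a x‖ / a / (1 - c) ^ 2 * |s - t| := by
  wlog hst : s ≤ t generalizing s t
  · rw [abs_sub_comm, abs_sub_comm s]
    exact this ht hs (le_of_not_ge hst)
  have hs0 : 0 < s := ha.trans_le hs.1
  have hft : variation (resolvCurve A x) t < ⊤ := (variation_mono _ ht.2).trans_lt hfin
  rw [abs_sub_comm, abs_sub_comm s, toReal_variation_sub hs0.le hst hft,
    abs_of_nonneg ENNReal.toReal_nonneg, abs_of_nonneg (sub_nonneg.2 hst)]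
  refine ENNReal.toReal_le_of_le_ofReal (mul_nonneg (by positivity) (sub_nonneg.2 hst)) ?_
  exact hA.eVariationOn_resolvCurve_le hω hc ha hs.1 hst
    ((mul_le_mul_of_nonneg_right ht.2 hω).trans hT) x

/-- On [a, T] the function is Lipschitz with constant q(a) / (1 - c)²; let a increase to t and use
continuity of q. It serves for the resolvent curve and for its variation, hence the general target
space. -/
theorem norm_deriv_le_quotient (hA : IsMAccretive ω A) (hI : IsInitialInterval ω c I)
    {Y : Type*} [NormedAddCommGroup Y] [NormedSpace ℝ Y] {F : ℝ → Y}
    (hF : ∀ a T, 0 < a → T ∈ I → ∀ s ∈ Icc a T, ∀ t ∈ Icc a T,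
      ‖F s - F t‖ ≤ ‖x - resolv A a x‖ / a / (1 - c) ^ 2 * |s - t|) (ht : t ∈ I) :
    ‖deriv F t‖ ≤ ‖x - resolv A t x‖ / t / (1 - c) ^ 2 := by
  have ht0 := hI.pos t ht
  have hc : 0 < 1 - c := sub_pos.2 hI.lt_one
  obtain ⟨T, hT, htT⟩ : ∃ T ∈ I, t < T :=
    Filter.nonempty_of_mem (inter_mem (nhdsWithin_le_nhds (s := Ioi t) (hI.isOpen.mem_nhds ht))
      self_mem_nhdsWithin)
  have hct : ContinuousAt (fun a => ‖x - resolv A a x‖ / a / (1 - c) ^ 2) t := by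
    have h1 : ContinuousAt (fun a => resolv A a x) t :=
      (hA.continuousOn_resolv_interval hI x).continuousAt (hI.isOpen.mem_nhds ht)
    exact ((h1.const_sub x).norm.div continuousAt_id ht0.ne').div_const _
  refine ge_of_tendsto (hct.tendsto.mono_left (nhdsWithin_le_nhds (s := Iio t))) ?_
  filter_upwards [Ioo_mem_nhdsLT ht0] with a ha
  refine norm_deriv_le_of_lip' (by have := ha.1; positivity) ?_
  filter_upwards [Icc_mem_nhds ha.2 htT] with s hs
  exact hF a T ha.1 hT s hs t ⟨ha.2.le, htT.le⟩

theorem norm_derivVariation_le (hA : IsMAccretive ω A) (hω : 0 ≤ ω)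
    (hI : IsInitialInterval ω c I) (hfin : ∀ t ∈ I, variation (resolvCurve A x) t < ⊤)
    (ht : t ∈ I) :
    ‖derivVariation (resolvCurve A x) t‖ ≤ ‖x - resolv A t x‖ / t / (1 - c) ^ 2 :=
  hA.norm_deriv_le_quotient hI (fun _ T ha hT _ hs _ ht =>
    hA.abs_toReal_variation_sub_le hω hI.lt_one ha (hI.mul_le T hT) (hfin T hT) hs ht) ht

theorem norm_deriv_resolvCurve_le (hA : IsMAccretive ω A) (hω : 0 ≤ ω)
    (hI : IsInitialInterval ω c I) (x : X) (ht : t ∈ I) :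
    ‖deriv (resolvCurve A x) t‖ ≤ ‖x - resolv A t x‖ / t / (1 - c) ^ 2 := by
  refine hA.norm_deriv_le_quotient hI (fun a T ha hT s hs r hr => ?_) ht
  wlog hrs : r ≤ s generalizing s r
  · rw [norm_sub_rev, abs_sub_comm]
    exact this r hr s hs (le_of_not_ge hrs)
  rw [abs_of_nonneg (sub_nonneg.2 hrs)]
  exact hA.norm_resolvCurve_sub_le_of_le hω hI.lt_one ha hr.1 hrs
    (hI.mul_le s (hI.mem_of_le T hT s (ha.trans_le hs.1) hs.2)) x

theorem resolvSet_subset_acVariationSet (hA : IsMAccretive ω A) (hω : 0 ≤ ω)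
    (hI : IsInitialInterval ω c I) :
    resolvSet A E I ⊆ acVariationSet A E I ∩ variationSet A E I := by
  intro x hx
  have hcl := hA.resolvSet_subset_closure hI hx
  have hac : IsACLoc (resolvCurve A x) I := fun T hT =>
    hA.absolutelyContinuousOnInterval_resolvCurve hω hI.lt_one hcl (hI.pos T hT).le
      (hI.mul_le T hT) (hA.integrableOn_quotient hI hx fun t ht =>
        hI.mem_of_le T hT t ht.1 ht.2.le)
  have hfin : ∀ t ∈ I, variation (resolvCurve A x) t < ⊤ := fun t ht => by
    have := (hac t ht).boundedVariationOn
    rw [uIcc_of_le (hI.pos t ht).le] at this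
    exact lt_top_iff_ne_top.2 this
  have hmem : E.Mem (I.indicator (derivVariation (resolvCurve A x))) := by
    rw [BanachFunctionSpace.mem_iff]
    refine ⟨((measurable_deriv _).indicator hI.isOpen.measurableSet).aemeasurable, ?_⟩
    rw [hA.mem_resolvSet_iff hI] at hx
    have hc : 0 < (1 - c) ^ 2 := by have := hI.lt_one; have : 0 < 1 - c := by linarith
                                    positivity
    refine (hx.const_mul (c := ENNReal.ofReal ((1 - c) ^ 2)⁻¹) (by simp)).mono
      (Eventually.of_forall fun t => ?_)
    by_cases ht : t ∈ I
    · simp only [ht, indicator_of_mem]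
      rw [← ofReal_norm, ← ENNReal.ofReal_mul (by positivity), inv_mul_eq_div]
      exact ENNReal.ofReal_le_ofReal (hA.norm_derivVariation_le hω hI hfin ht)
    · simp [ht]
  exact ⟨⟨hac, hmem⟩, hcl, hfin, hmem⟩

/-- Absolute continuity includes continuity at 0, which makes x a limit of the points J_t x of the
domain. -/
theorem acVariationSet_subset_variationSet (hA : IsMAccretive ω A)
    (hI : IsInitialInterval ω c I) : acVariationSet A E I ⊆ variationSet A E I := by
  rintro x ⟨hac, hmem⟩
  refine ⟨?_, fun t ht => ?_, hmem⟩
  · obtain ⟨T, hT⟩ := hI.nonempty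
    have hT0 := hI.pos T hT
    have hc := (hac T hT).continuousOn 0 left_mem_uIcc
    rw [uIcc_of_le hT0.le] at hc
    have hc' : Tendsto (resolvCurve A x) (𝓝[>] 0) (𝓝 (resolvCurve A x 0)) :=
      hc.tendsto.mono_left (nhdsWithin_le_of_mem
        (mem_of_superset (Ioo_mem_nhdsGT hT0) Ioo_subset_Icc_self))
    rw [resolvCurve_zero] at hc'
    refine mem_closure_of_tendsto hc' ?_
    filter_upwards [Ioo_mem_nhdsGT hT0] with t ht
    rw [resolvCurve_of_pos A x ht.1]
    exact hA.resolv_mem_dom ht.1 (hI.mul_lt_one (hI.mem_of_le T hT t ht.1 ht.2.le)) x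
  · have := (hac t ht).boundedVariationOn
    rw [uIcc_of_le (hI.pos t ht).le] at this
    exact lt_top_iff_ne_top.2 this

/-- The variation is Lipschitz on [a, t] for a > 0, so there it is the integral of its derivative
and dominates ‖J_a x - J_t x‖. Letting a → 0 avoids any regularity of the variation at 0;
convergence J_a x → x suffices. -/
theorem enorm_sub_resolv_le_lintegral (hA : IsMAccretive ω A) (hω : 0 ≤ ω)
    (hI : IsInitialInterval ω c I) (hx : x ∈ closure (dom A))
    (hfin : ∀ t ∈ I, variation (resolvCurve A x) t < ⊤) (ht : t ∈ I) :
    ‖x - resolv A t x‖ₑ ≤ ∫⁻ s in Ioc 0 t, ‖derivVariation (resolvCurve A x) s‖ₑ := by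
  have ht0 := hI.pos t ht
  have hc := hI.lt_one
  have hlim : Tendsto (fun a => ‖resolv A a x - resolv A t x‖ₑ) (𝓝[>] 0)
      (𝓝 ‖x - resolv A t x‖ₑ) :=
    ((hA.tendsto_resolv hω hx).sub_const _).enorm
  refine le_of_tendsto hlim ?_
  filter_upwards [Ioo_mem_nhdsGT ht0] with a ha
  set V : ℝ → ℝ := fun s => (variation (resolvCurve A x) s).toReal with hV
  have hL : 0 ≤ ‖x - resolv A a x‖ / a / (1 - c) ^ 2 := by have := ha.1; positivity
  have hlip : LipschitzOnWith (Real.toNNReal (‖x - resolv A a x‖ / a / (1 - c) ^ 2)) V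
      (uIcc a t) := by
    refine LipschitzOnWith.of_dist_le_mul fun s hs r hr => ?_
    rw [uIcc_of_le ha.2.le] at hs hr
    rw [Real.coe_toNNReal _ hL]
    exact hA.abs_toReal_variation_sub_le hω hc ha.1 (hI.mul_le t ht) (hfin t ht) hs hr
  have hftc := hlip.absolutelyContinuousOnInterval.integral_deriv_eq_sub
  have hfa : eVariationOn (resolvCurve A x) (Icc a t) ≠ ⊤ :=
    ((hA.eVariationOn_resolvCurve_le hω hc ha.1 le_rfl ha.2.le (hI.mul_le t ht) x).trans_lt
      ENNReal.ofReal_lt_top).ne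
  calc ‖resolv A a x - resolv A t x‖ₑ
      = edist (resolvCurve A x a) (resolvCurve A x t) := by
        rw [resolvCurve_of_pos A x ha.1, resolvCurve_of_pos A x ht0, edist_eq_enorm_sub]
    _ ≤ eVariationOn (resolvCurve A x) (Icc a t) :=
        eVariationOn.edist_le _ (left_mem_Icc.2 ha.2.le) (right_mem_Icc.2 ha.2.le)
    _ = ENNReal.ofReal (V t - V a) := by
        rw [hV, toReal_variation_sub ha.1.le ha.2.le (hfin t ht), ENNReal.ofReal_toReal hfa]
    _ ≤ ‖∫ s in a..t, deriv V s‖ₑ := by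
        rw [hftc, ← ofReal_norm]
        exact ENNReal.ofReal_le_ofReal (le_abs_self _)
    _ ≤ ∫⁻ s in Ioc a t, ‖deriv V s‖ₑ := by
        rw [intervalIntegral.integral_of_le ha.2.le]
        exact enorm_integral_le_lintegral_enorm _
    _ ≤ ∫⁻ s in Ioc 0 t, ‖derivVariation (resolvCurve A x) s‖ₑ :=
        lintegral_mono_set (Ioc_subset_Ioc_left ha.1.le)

theorem variationSet_subset_resolvSet (hA : IsMAccretive ω A) (hω : 0 ≤ ω)
    (hI : IsInitialInterval ω c I) (hE : E.HardyBounded) :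
    variationSet A E I ⊆ resolvSet A E I := by
  rintro x ⟨hcl, hfin, hmem⟩
  rw [hA.mem_resolvSet_iff hI]
  rw [BanachFunctionSpace.mem_iff] at hmem
  refine (hmem.2.hardy hE).mono (Eventually.of_forall fun t => ?_)
  by_cases ht : t ∈ I
  · have ht0 := hI.pos t ht
    simp only [ht, indicator_of_mem]
    rw [ENNReal.ofReal_div_of_pos ht0, ofReal_norm]
    refine ENNReal.div_le_div_right
      ((hA.enorm_sub_resolv_le_lintegral hω hI hcl hfin ht).trans_eq ?_) _
    refine setLIntegral_congr_fun measurableSet_Ioc fun s hs => ?_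
    simp only [indicator_of_mem (hI.mem_of_le t ht s hs.1 hs.2)]
  · simp [ht]

theorem resolvSet_eq_variationSet (hA : IsMAccretive ω A) (hω : 0 ≤ ω)
    (hI : IsInitialInterval ω c I) (hE : E.HardyBounded) :
    resolvSet A E I = variationSet A E I :=
  Subset.antisymm (fun _ hx => (hA.resolvSet_subset_acVariationSet hω hI hx).2)
    (hA.variationSet_subset_resolvSet hω hI hE)

theorem resolvSet_eq_acVariationSet (hA : IsMAccretive ω A) (hω : 0 ≤ ω)
    (hI : IsInitialInterval ω c I) (hE : E.HardyBounded) :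
    resolvSet A E I = acVariationSet A E I :=
  Subset.antisymm (fun _ hx => (hA.resolvSet_subset_acVariationSet hω hI hx).1)
    ((hA.acVariationSet_subset_variationSet hI).trans
      (hA.variationSet_subset_resolvSet hω hI hE))

end IsMAccretive

/-! ### Estimates for mild solutions -/

theorem exp_neg_two_mul_le {s : ℝ} (h0 : 0 ≤ s) (h1 : s ≤ 1 / 2) : Real.exp (-(2 * s)) ≤ 1 - s := by
  have h := Real.add_one_le_exp (2 * s)
  rw [Real.exp_neg, inv_le_comm₀ (Real.exp_pos _) (by linarith)]
  refine le_trans ?_ h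
  rw [inv_le_iff_one_le_mul₀ (by linarith)]
  nlinarith

/-- The grids of a mild solution need not end at T, only in (T - ε, T]. Continuity of u transfers
estimates at such end points to T as ε → 0. -/
theorem le_of_forall_exists_le_near {u : ℝ → X} (hu : ContinuousOn u (Ici 0)) {T : ℝ} (hT : 0 < T)
    {F : X → ℝ} (hF : Continuous F) {b : ℝ → ℝ} (hb : Continuous b) {ε₀ : ℝ} (hε₀ : 0 < ε₀)
    (h : ∀ ε, 0 < ε → ε < ε₀ → ∃ s ∈ Ioc (T - ε) T, F (u s) ≤ b ε) : F (u T) ≤ b 0 := by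
  choose! s hs hle using h
  have hev : ∀ᶠ ε in 𝓝[>] (0 : ℝ), ε ∈ Ioo 0 (min ε₀ T) := Ioo_mem_nhdsGT (lt_min hε₀ hT)
  have hlim : Tendsto s (𝓝[>] 0) (𝓝 T) := by
    have h1 : Tendsto (fun ε : ℝ => T - ε) (𝓝[>] 0) (𝓝 T) := by
      have : ContinuousAt (fun ε : ℝ => T - ε) 0 := by fun_prop
      simpa using this.tendsto.mono_left (nhdsWithin_le_nhds (s := Ioi 0))
    refine tendsto_of_tendsto_of_tendsto_of_le_of_le' h1 tendsto_const_nhds ?_ ?_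
    · filter_upwards [hev] with ε hε
      exact (hs ε hε.1 (hε.2.trans_le (min_le_left _ _))).1.le
    · filter_upwards [hev] with ε hε
      exact (hs ε hε.1 (hε.2.trans_le (min_le_left _ _))).2
  have huT : ContinuousAt u T := hu.continuousAt (Ici_mem_nhds hT)
  refine le_of_tendsto_of_tendsto ((hF.continuousAt.comp huT).tendsto.comp hlim)
    ((hb.tendsto 0).mono_left nhdsWithin_le_nhds) ?_
  filter_upwards [hev] with ε hε
  exact hle ε hε.1 (hε.2.trans_le (min_le_left _ _))

/-- A discrete Gronwall argument: one Euler step compared with the graph point (y, z) gives (1 - δω)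
‖v_{n+1} - y‖ ≤ ‖v_n - y‖ + δ(‖g_{n+1}‖ + ‖z‖). For δω ≤ 1/2 the factor is at least e^{-2δω}, whence
the exponential weight. -/
theorem IsMildSolution.norm_apply_sub_le (hA : IsAccretive ω A) (hω : 0 ≤ ω) {x : X} {u : ℝ → X}
    (hu : IsMildSolution A x u) {y z : X} (hy : (y, z) ∈ A) {T : ℝ} (hT : 0 < T) :
    ‖u T - y‖ ≤ Real.exp (2 * ω * T) * (‖x - y‖ + T * ‖z‖) := by
  have hε₀ : 0 < min T (1 / (2 * (ω + 1))) := lt_min hT (by positivity)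
  have key := le_of_forall_exists_le_near hu.1 hT (F := fun w => ‖w - y‖) (by fun_prop)
    -- The term 2ε pays for the initial value and for the sum of the errors g; the last ε is the
    -- distance from u to the step function.
    (b := fun ε => Real.exp (2 * ω * T) * (‖x - y‖ + 2 * ε + T * ‖z‖) + ε) (by fun_prop) hε₀ ?_
  · simpa using key
  intro ε hε hεlt
  have hεT : ε < T := hεlt.trans_le (min_le_left _ _)
  have hεω : ε * ω ≤ 1 / 2 := by
    have h1 := hεlt.le.trans (min_le_right _ _)
    rw [le_div_iff₀ (by positivity)] at h1
    nlinarith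
  obtain ⟨N, t, v, g, ht0, hstep, htN, htN', hmem, hsum, hv0, hclose⟩ := hu.2.2 T hT ε hε
  have hind : ∀ n ≤ N, Real.exp (-(2 * ω * t n)) * ‖v n - y‖ ≤
      ‖v 0 - y‖ + ∑ i ∈ Finset.range n, (t (i + 1) - t i) * ‖g (i + 1)‖ + t n * ‖z‖ ∧ 0 ≤ t n := by
    intro n
    induction n with
    | zero => intro _; simp [ht0]
    | succ n ih =>
      intro hn
      obtain ⟨ih, htn⟩ := ih (by omega)
      obtain ⟨hs1, hs2⟩ := hstep n (by omega)
      set δ := t (n + 1) - t n with hδ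
      have hδ0 : 0 < δ := sub_pos.2 hs1
      have hδω : δ * ω ≤ 1 / 2 := (mul_le_mul_of_nonneg_right hs2 hω).trans hεω
      have h1 := hA.norm_sub_le (hmem n (by omega)) hy hδ0 (by linarith)
      have e : v (n + 1) + δ • (g (n + 1) - δ⁻¹ • (v (n + 1) - v n)) - (y + δ • z) =
          (v n - y) + δ • g (n + 1) - δ • z := by
        match_scalars <;> field_simp <;> ring
      rw [e] at h1
      have h2 : ‖(v n - y) + δ • g (n + 1) - δ • z‖ ≤
          ‖v n - y‖ + δ * ‖g (n + 1)‖ + δ * ‖z‖ := by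
        refine (norm_sub_le _ _).trans (add_le_add ((norm_add_le _ _).trans ?_) ?_) <;>
        simp [norm_smul, abs_of_pos hδ0]
      have h3 := exp_neg_two_mul_le (mul_nonneg hδ0.le hω) hδω
      have h4 : Real.exp (-(2 * ω * t (n + 1))) =
          Real.exp (-(2 * ω * t n)) * Real.exp (-(2 * (δ * ω))) := by
        rw [← Real.exp_add]; congr 1; rw [hδ]; ring
      have h5 : Real.exp (-(2 * ω * t n)) ≤ 1 :=
        Real.exp_le_one_iff.2 (by have : 0 ≤ 2 * ω * t n := by positivity
                                  linarith)
      have h6 := Real.exp_pos (-(2 * ω * t n))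
      refine ⟨?_, by linarith⟩
      rw [Finset.sum_range_succ]
      have h7 : Real.exp (-(2 * (δ * ω))) * ‖v (n + 1) - y‖ ≤
          ‖v n - y‖ + δ * ‖g (n + 1)‖ + δ * ‖z‖ :=
        (mul_le_mul_of_nonneg_right h3 (norm_nonneg _)).trans (h1.trans h2)
      have h8 := mul_le_mul_of_nonneg_left h7 h6.le
      have h9 : 0 ≤ δ * ‖g (n + 1)‖ + δ * ‖z‖ := by positivity
      have h10 : t (n + 1) = t n + δ := by rw [hδ]; ring
      have h11 := mul_le_mul_of_nonneg_right h5 h9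
      rw [h4, mul_assoc, ← hδ]
      have h12 : t (n + 1) * ‖z‖ = t n * ‖z‖ + δ * ‖z‖ := by rw [h10]; ring
      rw [h12]
      nlinarith
  obtain ⟨hN, hN0⟩ := hind N le_rfl
  have hNpos : N ≠ 0 := by
    rintro rfl
    linarith
  obtain ⟨M, rfl⟩ := Nat.exists_eq_succ_of_ne_zero hNpos
  refine ⟨t (M + 1), ⟨htN, htN'⟩, ?_⟩
  have hc := hclose M (by omega) (t (M + 1)) ⟨(hstep M (by omega)).1, le_rfl⟩
  have h1 : ‖u (t (M + 1)) - y‖ ≤ ‖u (t (M + 1)) - v (M + 1)‖ + ‖v (M + 1) - y‖ := by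
    refine le_trans (le_of_eq ?_) (norm_add_le _ _)
    congr 1; abel
  have h2 : ‖v 0 - y‖ ≤ ‖v 0 - x‖ + ‖x - y‖ := by
    refine le_trans (le_of_eq ?_) (norm_add_le _ _)
    congr 1; abel
  have h3 : ‖v (M + 1) - y‖ ≤ Real.exp (2 * ω * t (M + 1)) *
      (‖x - y‖ + 2 * ε + T * ‖z‖) := by
    rw [Real.exp_neg, inv_mul_eq_div, div_le_iff₀ (Real.exp_pos _), mul_comm _ (Real.exp _)] at hN
    refine hN.trans (mul_le_mul_of_nonneg_left ?_ (Real.exp_pos _).le)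
    have : t (M + 1) * ‖z‖ ≤ T * ‖z‖ := by gcongr
    simp only [Nat.succ_eq_add_one] at hsum this ⊢
    linarith
  have h4 : Real.exp (2 * ω * t (M + 1)) ≤ Real.exp (2 * ω * T) :=
    Real.exp_le_exp.2 (by gcongr)
  have h5 : 0 ≤ ‖x - y‖ + 2 * ε + T * ‖z‖ := by positivity
  have h6 := mul_le_mul_of_nonneg_right h4 h5
  linarith

/-- With y = J_l x, the two-step inequality discretizes l d/dt ‖u - y‖ + (1 - lω) ‖u - y‖ ≤ ‖u - x‖.
Adding (1 - lω) ‖x - y‖ ≤ ‖u - x‖ + (1 - lω) ‖u - y‖ cancels the middle term and produces the factor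
2. After summation, ‖v_0 - y‖ - ‖v_N - y‖ is bounded by ‖v_0 - v_N‖, which tends to ‖x - u(T)‖. -/
theorem IsMildSolution.norm_sub_resolv_le (hA : IsMAccretive ω A) (hω : 0 ≤ ω) {x : X} {u : ℝ → X}
    (hu : IsMildSolution A x u) {l T : ℝ} (hl : 0 < l) (hlω : l * ω < 1) (hT : 0 < T) :
    (1 - l * ω) * T * ‖x - resolv A l x‖ ≤
      l * ‖x - u T‖ + 2 * ∫ s in (0 : ℝ)..T, ‖x - u s‖ := by
  set y := resolv A l x with hy
  have hyA : (y, l⁻¹ • (x - y)) ∈ A := hA.resolv_mem hl hlω x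
  have hyx : y + l • (l⁻¹ • (x - y)) = x := IsMAccretive.resolv_add_smul hl x
  have hε₀ : 0 < min T (1 / (ω + 1)) := lt_min hT (by positivity)
  have hlω' : 0 < 1 - l * ω := by linarith
  have hlω1 : 1 - l * ω ≤ 1 := by have : 0 ≤ l * ω := by positivity
                                  linarith
  have hcont : ContinuousOn (fun s => ‖x - u s‖) (Ici 0) := by
    have := hu.1
    fun_prop
  have hii : ∀ a b, 0 ≤ a → a ≤ b → IntervalIntegrable (fun s => ‖x - u s‖) volume a b :=
    fun a b ha hab => (hcont.mono (by
      rw [uIcc_of_le hab]; exact fun s hs => ha.trans hs.1)).intervalIntegrable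
  -- The minus sign brings the end-point term to the side where an upper bound passes to the limit.
  -- The error 3lε collects the initial value, the final value and the sum of the g.
  have key := le_of_forall_exists_le_near hu.1 hT (F := fun w => -(l * ‖x - w‖)) (by fun_prop)
    (b := fun ε => 2 * ((∫ s in (0 : ℝ)..T, ‖x - u s‖) + ε * T) + 3 * l * ε -
      (1 - l * ω) * (T - ε) * ‖x - y‖) (by fun_prop) hε₀ ?_
  · simp only [zero_mul, add_zero, mul_zero, sub_zero] at key
    linarith
  intro ε hε hεlt
  have hεT : ε < T := hεlt.trans_le (min_le_left _ _)
  have hεω : ε * ω < 1 := by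
    have h1 := hεlt.le.trans (min_le_right _ _)
    rw [le_div_iff₀ (by positivity)] at h1
    nlinarith
  obtain ⟨N, t, v, g, ht0, hstep, htN, htN', hmem, hsum, hv0, hclose⟩ := hu.2.2 T hT ε hε
  have hind : ∀ n ≤ N, l * ‖v n - y‖ + (1 - l * ω) * t n * ‖x - y‖ ≤
      l * ‖v 0 - y‖ + 2 * ((∫ s in (0 : ℝ)..t n, ‖x - u s‖) + ε * t n) +
        l * ∑ i ∈ Finset.range n, (t (i + 1) - t i) * ‖g (i + 1)‖ ∧ 0 ≤ t n := by
    intro n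
    induction n with
    | zero => intro _; simp [ht0]
    | succ n ih =>
      intro hn
      obtain ⟨ih, htn⟩ := ih (by omega)
      obtain ⟨hs1, hs2⟩ := hstep n (by omega)
      set δ := t (n + 1) - t n with hδ
      have hδ0 : 0 < δ := sub_pos.2 hs1
      have hδω : δ * ω < 1 := (mul_le_mul_of_nonneg_right hs2 hω).trans_lt hεω
      have h1 := hA.1.norm_sub_le_two_step hω (hmem n (by omega)) hyA hδ0 hl hδω
      have e : v (n + 1) + δ • (g (n + 1) - δ⁻¹ • (v (n + 1) - v n)) - y =
          (v n - y) + δ • g (n + 1) := by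
        match_scalars <;> field_simp <;> ring
      rw [hyx, e] at h1
      have h2 : ‖(v n - y) + δ • g (n + 1)‖ ≤ ‖v n - y‖ + δ * ‖g (n + 1)‖ := by
        refine (norm_add_le _ _).trans ?_
        simp [norm_smul, abs_of_pos hδ0]
      have h3 : ‖x - y‖ ≤ ‖v (n + 1) - x‖ + ‖v (n + 1) - y‖ := by
        rw [norm_sub_rev (v (n + 1)) x]
        refine le_trans (le_of_eq ?_) (norm_add_le _ _)
        congr 1; abel
      have h4 : δ * ‖v (n + 1) - x‖ ≤ (∫ s in t n..t (n + 1), ‖x - u s‖) + ε * δ := by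
        have h5 : ∫ s in t n..t (n + 1), (‖v (n + 1) - x‖ - ε) ≤
            ∫ s in t n..t (n + 1), ‖x - u s‖ := by
          refine intervalIntegral.integral_mono_on_of_le_Ioo hs1.le (by simp)
            (hii _ _ htn hs1.le) fun s hs => ?_
          have h6 := hclose n (by omega) s ⟨hs.1, hs.2.le⟩
          have h7 : ‖v (n + 1) - x‖ ≤ ‖u s - v (n + 1)‖ + ‖x - u s‖ := by
            rw [norm_sub_rev (u s), norm_sub_rev x]
            refine le_trans (le_of_eq ?_) (norm_add_le _ _)
            congr 1; abel
          linarith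
        rw [intervalIntegral.integral_const, smul_eq_mul, ← hδ] at h5
        linarith
      have hi := intervalIntegral.integral_add_adjacent_intervals (hii 0 (t n) le_rfl htn)
        (hii (t n) (t (n + 1)) htn hs1.le)
      refine ⟨?_, by linarith⟩
      rw [Finset.sum_range_succ, ← hi, ← hδ]
      have h10 : t (n + 1) = t n + δ := by rw [hδ]; ring
      have h11 : (1 - l * ω) * δ * ‖x - y‖ ≤ δ * ‖v (n + 1) - x‖ +
          (1 - l * ω) * δ * ‖v (n + 1) - y‖ := by
        have h12 := mul_le_mul_of_nonneg_left h3 (mul_nonneg hlω'.le hδ0.le)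
        have h13 : (1 - l * ω) * (δ * ‖v (n + 1) - x‖) ≤ 1 * (δ * ‖v (n + 1) - x‖) := by gcongr
        linarith
      have h14 := mul_le_mul_of_nonneg_left h2 hl.le
      have h15 : (1 - l * ω) * t (n + 1) * ‖x - y‖ =
        (1 - l * ω) * t n * ‖x - y‖ + (1 - l * ω) * δ * ‖x - y‖ := by rw [h10]; ring
      have h16 : ε * t (n + 1) = ε * t n + ε * δ := by rw [h10]; ring
      rw [h15, h16]
      linarith
  obtain ⟨hN, hN0⟩ := hind N le_rfl
  have hNpos : N ≠ 0 := by
    rintro rfl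
    linarith
  obtain ⟨M, rfl⟩ := Nat.exists_eq_succ_of_ne_zero hNpos
  refine ⟨t (M + 1), ⟨htN, htN'⟩, ?_⟩
  simp only [Nat.succ_eq_add_one] at *
  have hc := hclose M (by omega) (t (M + 1)) ⟨(hstep M (by omega)).1, le_rfl⟩
  have h1 : ‖v 0 - y‖ ≤ ‖v 0 - x‖ + ‖x - u (t (M + 1))‖ + ‖u (t (M + 1)) - v (M + 1)‖ +
      ‖v (M + 1) - y‖ := by
    refine le_trans (le_of_eq ?_) (norm_add₄_le)
    congr 1; abel
  have h2 := mul_le_mul_of_nonneg_left h1 hl.le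
  have h3 := mul_le_mul_of_nonneg_left hsum hl.le
  have h4 := mul_le_mul_of_nonneg_left hv0 hl.le
  have h5 := mul_le_mul_of_nonneg_left hc hl.le
  have h6 : ε * t (M + 1) ≤ ε * T := by gcongr
  have h7 : (∫ s in (0 : ℝ)..t (M + 1), ‖x - u s‖) ≤ ∫ s in (0 : ℝ)..T, ‖x - u s‖ := by
    rw [← intervalIntegral.integral_add_adjacent_intervals (hii 0 _ le_rfl hN0) (hii _ T hN0 htN')]
    have := intervalIntegral.integral_nonneg (μ := volume) (f := fun s => ‖x - u s‖) htN'
      fun s _ => norm_nonneg _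
    linarith
  have h8 : (1 - l * ω) * (T - ε) * ‖x - y‖ ≤ (1 - l * ω) * t (M + 1) * ‖x - y‖ := by gcongr
  linarith

theorem isMildSolution_semigroup {x : X} (h : ∃ u, IsMildSolution A x u) :
    IsMildSolution A x (fun t => semigroup A t x) := by
  have e : (fun t => semigroup A t x) = h.choose := by
    funext t
    rw [semigroup, dif_pos h]
  rw [e]
  exact h.choose_spec

/-- Both estimates hold for any mild solution, so uniqueness is not needed to handle the chosen one.
The return direction takes l = T = t in the lower estimate. -/
theorem IsMAccretive.resolvSet_eq_semigroupSet (hA : IsMAccretive ω A) (hω : 0 ≤ ω)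
    (hE : E.HardyBounded) {τ : ℝ} (hτ : 0 < τ) (hτω : τ * ω < 1)
    (hex : ∀ x ∈ closure (dom A), ∃ u, IsMildSolution A x u) :
    resolvSet A E (Ioo 0 τ) = semigroupSet A E (Ioo 0 τ) := by
  have hI := isInitialInterval_Ioo hω hτ hτω
  ext x
  suffices H : x ∈ closure (dom A) → (x ∈ resolvSet A E (Ioo 0 τ) ↔
      E.Mem ((Ioo 0 τ).indicator fun t => ‖x - semigroup A t x‖ / t)) from
    ⟨fun hx => have hcl := hA.resolvSet_subset_closure hI hx
      ⟨hcl, (H hcl).1 hx⟩, fun hx => (H hx.1).2 hx.2⟩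
  intro hcl
  have hu := isMildSolution_semigroup (hex x hcl)
  set u := fun t => semigroup A t x with hu_def
  have hcu : ContinuousOn u (Ioo 0 τ) := hu.1.mono fun t ht => ht.1.le
  change _ ↔ E.Mem ((Ioo 0 τ).indicator fun t => ‖x - u t‖ / t)
  rw [mem_quotient_iff hI hcu]
  constructor
  · intro hx
    rw [hA.resolvSet_eq_kSet hω hI, mem_kSet_iff isOpen_Ioo] at hx
    set C := 1 + Real.exp (2 * ω * τ) with hC
    have hC0 : 0 < C := by positivity
    refine (hx.const_mul (c := ENNReal.ofReal C) (by simp)).mono (Eventually.of_forall fun t => ?_)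
    by_cases ht : t ∈ Ioo 0 τ
    · simp only [ht, indicator_of_mem]
      rw [ENNReal.ofReal_div_of_pos ht.1, ← mul_div_assoc]
      refine ENNReal.div_le_div_right ?_ _
      have h := le_mul_kFun_add (A := A) (a := ENNReal.ofReal ‖x - u t‖) (x := x) ht.1 hC0 le_rfl
        fun v f hv => ?_
      · simpa using h
      refine ENNReal.ofReal_le_ofReal ?_
      have h1 := hu.norm_apply_sub_le hA.1 hω hv ht.1
      have h2 : ‖x - u t‖ ≤ ‖x - v‖ + ‖u t - v‖ := by
        rw [norm_sub_rev (u t)]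
        refine le_trans (le_of_eq ?_) (norm_add_le _ _)
        congr 1; abel
      have h3 : 0 ≤ t * ‖f‖ := mul_nonneg ht.1.le (norm_nonneg _)
      have h4 : Real.exp (2 * ω * t) ≤ Real.exp (2 * ω * τ) :=
        Real.exp_le_exp.2 (by have := ht.2.le; gcongr)
      have h5 := mul_le_mul_of_nonneg_right h4 (add_nonneg (norm_nonneg (x - v)) h3)
      rw [hC]
      linarith
    · simp [ht]
  · intro hx
    rw [hA.mem_resolvSet_iff hI]
    have hc : 0 < 1 - τ * ω := by linarith
    have h := (hx.add ((hx.hardy hE).const_mul (c := 2) (by simp))).const_mul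
      (c := ENNReal.ofReal (1 - τ * ω)⁻¹) (by simp)
    refine h.mono (Eventually.of_forall fun t => ?_)
    by_cases ht : t ∈ Ioo 0 τ
    · have ht0 := ht.1
      have hlow := hu.norm_sub_resolv_le hA hω ht.1 (hI.mul_lt_one ht) ht.1
      have hle : (1 - τ * ω) * t * ‖x - resolv A t x‖ ≤ (1 - t * ω) * t * ‖x - resolv A t x‖ := by
        gcongr; exact ht.2.le
      have hcont : ContinuousOn (fun s => ‖x - u s‖) (Icc 0 t) := by
        have := hu.1.mono (fun s (hs : s ∈ Icc 0 t) => hs.1)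
        fun_prop
      have hint : IntegrableOn (fun s => ‖x - u s‖) (Ioc 0 t) :=
        (hcont.integrableOn_Icc).mono_set Ioc_subset_Icc_self
      set J := ∫ s in (0 : ℝ)..t, ‖x - u s‖ with hJ
      have hJ0 : 0 ≤ J := intervalIntegral.integral_nonneg ht0.le fun s _ => norm_nonneg _
      -- Since 1 / t ≤ 1 / s on (0, t], the mean of ‖x - u‖ is at most the integral of ‖x - u(s)‖ /
      -- s; one more division by t gives its Hardy transform.
      have h1 : ENNReal.ofReal (J / t) ≤ ∫⁻ s in Ioc 0 t,
          (Ioo 0 τ).indicator (fun t => ENNReal.ofReal (‖x - u t‖ / t)) s := by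
        rw [hJ, intervalIntegral.integral_of_le ht0.le, ← integral_div,
          ofReal_integral_eq_lintegral_ofReal (hint.div_const t)
          (Eventually.of_forall fun s => by positivity)]
        refine setLIntegral_mono' measurableSet_Ioc fun s hs => ?_
        rw [indicator_of_mem (show s ∈ Ioo 0 τ from ⟨hs.1, hs.2.trans_lt ht.2⟩)]
        refine ENNReal.ofReal_le_ofReal ?_
        exact div_le_div_of_nonneg_left (norm_nonneg _) hs.1 hs.2
      have h2 : ENNReal.ofReal (‖x - resolv A t x‖ / t) ≤ ENNReal.ofReal (1 - τ * ω)⁻¹ *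
          (ENNReal.ofReal (‖x - u t‖ / t) + 2 * (ENNReal.ofReal (J / t) / ENNReal.ofReal t)) := by
        rw [← ENNReal.ofReal_div_of_pos ht0, ← ENNReal.ofReal_ofNat, ← ENNReal.ofReal_mul (by simp),
          ← ENNReal.ofReal_add (by positivity) (by positivity), ← ENNReal.ofReal_mul (by positivity)]
        refine ENNReal.ofReal_le_ofReal ?_
        rw [inv_mul_eq_div, le_div_iff₀ hc]
        have e : ‖x - u t‖ / t + 2 * (J / t / t) = (t * ‖x - u t‖ + 2 * J) / (t * t) := by
          field_simp
        rw [e, le_div_iff₀ (by positivity)]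
        have e2 : ‖x - resolv A t x‖ / t * (1 - τ * ω) * (t * t) =
          (1 - τ * ω) * t * ‖x - resolv A t x‖ := by field_simp
        rw [e2]
        exact hle.trans hlow
      rw [indicator_of_mem ht, indicator_of_mem ht]
      refine h2.trans ?_
      gcongr
    · simp [ht]

/-! ### Existence of mild solutions -/

theorem mul_sqrt_add_mul_sqrt_le {l m p q r : ℝ} (hl : 0 < l) (hm : 0 < m) (hp : 0 ≤ p)
    (hq : 0 ≤ q) (h : l * p + m * q = (l + m) * r) :
    l * √p + m * √q ≤ (l + m) * √r := by
  have hr : 0 ≤ r := by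
    have h1 : 0 ≤ (l + m) * r := by rw [← h]; positivity
    exact nonneg_of_mul_nonneg_right h1 (by positivity)
  refine le_of_sq_le_sq ?_ (by positivity)
  rw [mul_pow, Real.sq_sqrt hr]
  have h1 : (l * √p + m * √q) ^ 2 ≤ (l + m) * (l * p + m * q) := by
    have h2 : 0 ≤ l * m * (√p - √q) ^ 2 := by positivity
    have e : (l * √p + m * √q) ^ 2 =
        (l + m) * (l * √p ^ 2 + m * √q ^ 2) - l * m * (√p - √q) ^ 2 := by ring
    rw [e, Real.sq_sqrt hp, Real.sq_sqrt hq]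
    linarith
  rw [h] at h1
  linarith

namespace IsMAccretive

variable {l m : ℝ} {x y f : X}

theorem pow_mul_norm_iterate_sub_iterate_le (hA : IsMAccretive ω A) (hl : 0 < l)
    (hlω : l * ω < 1) (x y : X) (n : ℕ) :
    (1 - l * ω) ^ n * ‖(resolv A l)^[n] x - (resolv A l)^[n] y‖ ≤ ‖x - y‖ := by
  induction n with
  | zero => simp
  | succ n ih =>
    rw [Function.iterate_succ_apply', Function.iterate_succ_apply', pow_succ, mul_assoc]
    refine le_trans (mul_le_mul_of_nonneg_left (hA.norm_resolv_sub_le hl hlω _ _) ?_) ih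
    exact pow_nonneg (by linarith) _

theorem pow_mul_norm_iterate_sub_le (hA : IsMAccretive ω A) (hω : 0 ≤ ω) (hl : 0 < l)
    (hlω : l * ω < 1) (hx : (x, f) ∈ A) (n : ℕ) :
    (1 - l * ω) ^ n * ‖(resolv A l)^[n] x - x‖ ≤ n * l * ‖f‖ := by
  have h0 : 0 < 1 - l * ω := by linarith
  have h1 : 1 - l * ω ≤ 1 := by have : 0 ≤ l * ω := by positivity
                                linarith
  induction n with
  | zero => simp
  | succ n ih =>
    rw [Function.iterate_succ_apply']
    set w := (resolv A l)^[n] x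
    have h2 : ‖resolv A l w - x‖ ≤ ‖resolv A l w - resolv A l x‖ + ‖x - resolv A l x‖ := by
      rw [norm_sub_rev x]
      refine le_trans (le_of_eq ?_) (norm_add_le _ _)
      congr 1; abel
    have h3 := hA.norm_resolv_sub_le hl hlω w x
    have h4 := hA.norm_sub_resolv_le_of_mem hl hlω hx
    have h5 : (1 - l * ω) ^ n ≤ 1 := pow_le_one₀ h0.le h1
    have h6 : 0 < (1 - l * ω) ^ n := by positivity
    have h7 : (1 - l * ω) * ‖resolv A l w - x‖ ≤ ‖w - x‖ + l * ‖f‖ := by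
      nlinarith
    have h8 := mul_le_mul_of_nonneg_left h7 h6.le
    have h9 : (1 - l * ω) ^ n * (l * ‖f‖) ≤ 1 * (l * ‖f‖) := by gcongr
    rw [pow_succ]
    push_cast
    linarith

/-- The Crandall-Liggett estimate. The two-step inequality bounds the (i+1, j+1) distance by a
weighted mean of its (i+1, j) and (i, j+1) neighbours. The radicand reproduces exactly under this
mean with weights l and m, and concavity of the square root closes the induction. -/
theorem pow_mul_pow_mul_norm_iterate_sub_iterate_le (hA : IsMAccretive ω A) (hω : 0 ≤ ω)
    (hl : 0 < l) (hm : 0 < m) (hlω : l * ω < 1) (hmω : m * ω < 1) (hx : (x, f) ∈ A) (i j : ℕ) :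
    (1 - l * ω) ^ i * (1 - m * ω) ^ j * ‖(resolv A l)^[i] x - (resolv A m)^[j] x‖ ≤
      ‖f‖ * √((i * l - j * m) ^ 2 + i * l ^ 2 + j * m ^ 2) := by
  have hρ : 0 < 1 - l * ω := by linarith
  have hσ : 0 < 1 - m * ω := by linarith
  induction i generalizing j with
  | zero =>
    have h := hA.pow_mul_norm_iterate_sub_le hω hm hmω hx j
    simp only [pow_zero, one_mul, Function.iterate_zero, id]
    rw [norm_sub_rev]
    refine h.trans ?_
    rw [mul_comm]
    refine mul_le_mul_of_nonneg_left (Real.le_sqrt_of_sq_le ?_) (norm_nonneg _)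
    have : 0 ≤ (j : ℝ) * m ^ 2 := by positivity
    push_cast
    linarith
  | succ i ihi =>
    induction j with
    | zero =>
      have h := hA.pow_mul_norm_iterate_sub_le hω hl hlω hx (i + 1)
      simp only [pow_zero, mul_one, Function.iterate_zero, id]
      refine h.trans ?_
      rw [mul_comm]
      refine mul_le_mul_of_nonneg_left (Real.le_sqrt_of_sq_le ?_) (norm_nonneg _)
      have : 0 ≤ ((i + 1 : ℕ) : ℝ) * l ^ 2 := by positivity
      push_cast at *
      linarith
    | succ j ihj =>
      have ihi' := ihi (j + 1)
      set u := (resolv A l)^[i] x with hu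
      set v := (resolv A m)^[j] x with hv
      have eu : (resolv A l)^[i + 1] x = resolv A l u := Function.iterate_succ_apply' _ _ _
      have ev : (resolv A m)^[j + 1] x = resolv A m v := Function.iterate_succ_apply' _ _ _
      rw [eu] at ihj
      rw [ev] at ihi'
      rw [eu, ev]
      have h := hA.1.norm_sub_le_two_step hω (hA.resolv_mem hl hlω u) (hA.resolv_mem hm hmω v)
        hl hm hlω
      rw [resolv_add_smul hm, resolv_add_smul hl] at h
      set a := ‖resolv A l u - resolv A m v‖
      set P := (1 - l * ω) ^ i with hP
      set Q := (1 - m * ω) ^ j with hQ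
      have hP0 : 0 < P := by positivity
      have hQ0 : 0 < Q := by positivity
      have eP : (1 - l * ω) ^ (i + 1) = P * (1 - l * ω) := pow_succ _ _
      have eQ : (1 - m * ω) ^ (j + 1) = Q * (1 - m * ω) := pow_succ _ _
      rw [eP] at ihj
      rw [eQ] at ihi'
      rw [eP, eQ]
      set b := P * (1 - l * ω) * (Q * (1 - m * ω)) * a with hb
      set b₁ := P * (1 - l * ω) * Q * ‖resolv A l u - v‖ with hb₁
      set b₂ := P * (Q * (1 - m * ω)) * ‖u - resolv A m v‖ with hb₂
      have hb₁0 : 0 ≤ b₁ := by positivity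
      have hb₂0 : 0 ≤ b₂ := by positivity
      set K := l + m - l * m * ω with hK
      have hK0 : 0 < K := by
        have : l * m * ω = m * (l * ω) := by ring
        rw [hK, this]
        nlinarith
      have h1 : K * b ≤ l * (1 - m * ω) * b₁ + m * (1 - l * ω) * b₂ := by
        have h2 := mul_le_mul_of_nonneg_left h
          (show 0 ≤ P * (1 - l * ω) * (Q * (1 - m * ω)) by positivity)
        rw [hb, hb₁, hb₂]
        linarith
      -- These two bounds replace the ω-dependent weights by l / (l + m) and m / (l + m), the powers
      -- of 1 - lω and 1 - mω having been absorbed into b, b₁ and b₂.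
      have h3 : (l + m) * (l * (1 - m * ω)) ≤ K * l := by
        have : 0 ≤ l * m * m * ω := by positivity
        rw [hK]; linarith
      have h4 : (l + m) * (m * (1 - l * ω)) ≤ K * m := by
        have : 0 ≤ l * l * m * ω := by positivity
        rw [hK]; linarith
      have h5 : (l + m) * b ≤ l * b₁ + m * b₂ := by
        refine le_of_mul_le_mul_left ?_ hK0
        have h6 := mul_le_mul_of_nonneg_right h3 hb₁0
        have h7 := mul_le_mul_of_nonneg_right h4 hb₂0
        have h8 := mul_le_mul_of_nonneg_left h1 (by positivity : 0 ≤ l + m)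
        linarith
      have h9 := mul_sqrt_add_mul_sqrt_le (l := l) (m := m)
        (p := (((i + 1 : ℕ) : ℝ) * l - j * m) ^ 2 + ((i + 1 : ℕ) : ℝ) * l ^ 2 + j * m ^ 2)
        (q := (i * l - ((j + 1 : ℕ) : ℝ) * m) ^ 2 + i * l ^ 2 + ((j + 1 : ℕ) : ℝ) * m ^ 2)
        (r := (((i + 1 : ℕ) : ℝ) * l - ((j + 1 : ℕ) : ℝ) * m) ^ 2 + ((i + 1 : ℕ) : ℝ) * l ^ 2 +
          ((j + 1 : ℕ) : ℝ) * m ^ 2) hl hm (by positivity) (by positivity) (by push_cast; ring)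
      refine le_of_mul_le_mul_left ?_ (by positivity : 0 < l + m)
      have h10 := mul_le_mul_of_nonneg_left ihj hl.le
      have h11 := mul_le_mul_of_nonneg_left ihi' hm.le
      have h12 := mul_le_mul_of_nonneg_left h9 (norm_nonneg f)
      linarith

/-- The previous estimate needs a starting point in the domain. A nearby y there costs ε / 4 for
each of the two iterates, which are Lipschitz with constant M, and ε / 2 is left for y itself. -/
theorem exists_norm_iterate_sub_iterate_le (hA : IsMAccretive ω A) (hω : 0 ≤ ω)
    (hx : x ∈ closure (dom A)) {T : ℝ} (hT : 0 ≤ T) {ε : ℝ} (hε : 0 < ε) :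
    ∃ δ > 0, δ * ω ≤ 1 / 2 ∧ ∀ l m : ℝ, 0 < l → l ≤ δ → 0 < m → m ≤ δ → ∀ i j : ℕ, i * l ≤ T →
      j * m ≤ T → |i * l - j * m| ≤ δ →
      ‖(resolv A l)^[i] x - (resolv A m)^[j] x‖ ≤ ε := by
  set M := Real.exp (2 * ω * T) with hM
  have hM0 : 0 < M := Real.exp_pos _
  have hpow : ∀ l : ℝ, 0 < l → l * ω ≤ 1 / 2 → ∀ i : ℕ, i * l ≤ T → M⁻¹ ≤ (1 - l * ω) ^ i := by
    intro l hl hlω i hi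
    have h1 := exp_neg_two_mul_le (mul_nonneg hl.le hω) hlω
    refine le_trans ?_ (pow_le_pow_left₀ (Real.exp_pos _).le h1 i)
    rw [hM, ← Real.exp_neg, ← Real.exp_nat_mul]
    refine Real.exp_le_exp.2 ?_
    have := mul_le_mul_of_nonneg_left hi hω
    linarith
  obtain ⟨y, ⟨f, hy⟩, hxy⟩ := Metric.mem_closure_iff.1 hx (ε / (4 * M)) (by positivity)
  rw [dist_eq_norm] at hxy
  have hc : ContinuousAt (fun δ : ℝ => M * M * (‖f‖ * √(δ ^ 2 + 2 * T * δ))) 0 := by fun_prop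
  have hev : ∀ᶠ δ in 𝓝[>] (0 : ℝ), M * M * (‖f‖ * √(δ ^ 2 + 2 * T * δ)) < ε / 2 ∧ δ * ω < 1 / 2 := by
    refine nhdsWithin_le_nhds (Filter.Eventually.and ?_ ?_)
    · exact hc.eventually_lt continuousAt_const (by simpa using hε)
    · exact (continuous_id.mul continuous_const).continuousAt.eventually_lt
        continuousAt_const (by simp)
  obtain ⟨δ, ⟨hδ1, hδ2⟩, hδ0⟩ := (hev.and self_mem_nhdsWithin).exists
  have hδ0 : 0 < δ := hδ0
  refine ⟨δ, hδ0, hδ2.le, fun l m hl hlδ hm hmδ i j hi hj hij => ?_⟩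
  have hlω : l * ω ≤ 1 / 2 := (mul_le_mul_of_nonneg_right hlδ hω).trans hδ2.le
  have hmω : m * ω ≤ 1 / 2 := (mul_le_mul_of_nonneg_right hmδ hω).trans hδ2.le
  have hlip : ∀ l : ℝ, 0 < l → l * ω ≤ 1 / 2 → ∀ i : ℕ, i * l ≤ T →
      ‖(resolv A l)^[i] x - (resolv A l)^[i] y‖ ≤ M * ‖x - y‖ := fun l hl hlω i hi => by
    have h1 := hA.pow_mul_norm_iterate_sub_iterate_le hl (by linarith) x y i
    have h2 := (mul_le_mul_of_nonneg_right (hpow l hl hlω i hi) (norm_nonneg _)).trans h1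
    rwa [inv_mul_eq_div, div_le_iff₀ hM0, mul_comm] at h2
  have h1 := hlip l hl hlω i hi
  have h2 := hlip m hm hmω j hj
  have h3 := hA.pow_mul_pow_mul_norm_iterate_sub_iterate_le hω hl hm (by linarith) (by linarith)
    hy i j
  have h4 : M⁻¹ * M⁻¹ ≤ (1 - l * ω) ^ i * (1 - m * ω) ^ j :=
    mul_le_mul (hpow l hl hlω i hi) (hpow m hm hmω j hj) (by positivity)
      (pow_nonneg (by linarith) _)
  have h5 : √((i * l - j * m) ^ 2 + i * l ^ 2 + j * m ^ 2) ≤ √(δ ^ 2 + 2 * T * δ) := by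
    refine Real.sqrt_le_sqrt ?_
    have e1 : (i * l - j * m) ^ 2 ≤ δ ^ 2 := by
      rw [← sq_abs]
      exact pow_le_pow_left₀ (abs_nonneg _) hij 2
    have e2 : i * l ^ 2 ≤ T * δ := by
      rw [pow_two, ← mul_assoc]
      exact mul_le_mul hi hlδ hl.le hT
    have e3 : j * m ^ 2 ≤ T * δ := by
      rw [pow_two, ← mul_assoc]
      exact mul_le_mul hj hmδ hm.le hT
    linarith
  have h6 := (mul_le_mul_of_nonneg_right h4 (norm_nonneg _)).trans
    (h3.trans (mul_le_mul_of_nonneg_left h5 (norm_nonneg f)))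
  have h7 : ‖(resolv A l)^[i] y - (resolv A m)^[j] y‖ ≤
      M * M * (‖f‖ * √(δ ^ 2 + 2 * T * δ)) := by
    rwa [← mul_inv, inv_mul_eq_div, div_le_iff₀ (by positivity), mul_comm] at h6
  have h8 : M * ‖x - y‖ ≤ ε / 4 := by
    have := mul_le_mul_of_nonneg_left hxy.le hM0.le
    refine this.trans_eq ?_
    field_simp
  have h9 : ‖(resolv A l)^[i] x - (resolv A m)^[j] x‖ ≤
      ‖(resolv A l)^[i] x - (resolv A l)^[i] y‖ + ‖(resolv A l)^[i] y - (resolv A m)^[j] y‖ +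
        ‖(resolv A m)^[j] x - (resolv A m)^[j] y‖ := by
    rw [norm_sub_rev ((resolv A m)^[j] x)]
    refine le_trans (le_of_eq ?_) norm_add₃_le
    congr 1; abel
  linarith

theorem floor_div_mul_le_and_sub_lt {t l : ℝ} (ht : 0 ≤ t) (hl : 0 < l) :
    ⌊t / l⌋₊ * l ≤ t ∧ t - ⌊t / l⌋₊ * l < l := by
  have h1 := Nat.floor_le (div_nonneg ht hl.le)
  have h2 := Nat.lt_floor_add_one (t / l)
  rw [le_div_iff₀ hl] at h1
  rw [div_lt_iff₀ hl] at h2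
  constructor <;> linarith

/-- The exponential formula: the implicit Euler schemes converge. -/
theorem exists_forall_norm_sub_iterate_le [CompleteSpace X] (hA : IsMAccretive ω A) (hω : 0 ≤ ω)
    (hx : x ∈ closure (dom A)) :
    ∃ u : ℝ → X, ∀ T ≥ 0, ∀ ε > 0, ∃ δ > 0, δ * ω ≤ 1 / 2 ∧ ∀ m : ℝ, 0 < m → m ≤ δ → ∀ j : ℕ,
      j * m ≤ T → ∀ t ∈ Icc 0 T, |t - j * m| ≤ δ → ‖u t - (resolv A m)^[j] x‖ ≤ ε := by
  set l : ℕ → ℝ := fun k => 1 / ((k : ℝ) + 1) with hl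
  have hl0 : ∀ k, 0 < l k := fun k => by positivity
  have hlim : Tendsto l atTop (𝓝 0) := tendsto_one_div_add_atTop_nhds_zero_nat
  set U : ℕ → ℝ → X := fun k t => (resolv A (l k))^[⌊t / l k⌋₊] x with hU
  have hcau : ∀ t : ℝ, 0 ≤ t → ∃ w, Tendsto (fun k => U k t) atTop (𝓝 w) := by
    intro t ht
    refine cauchySeq_tendsto_of_complete (Metric.cauchySeq_iff'.2 fun ε hε => ?_)
    obtain ⟨δ, hδ, -, H⟩ := hA.exists_norm_iterate_sub_iterate_le hω hx ht (half_pos hε)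
    obtain ⟨N, hN⟩ := eventually_atTop.1 (hlim.eventually (eventually_lt_nhds hδ))
    refine ⟨N, fun n hn => ?_⟩
    rw [dist_eq_norm]
    obtain ⟨a1, a2⟩ := floor_div_mul_le_and_sub_lt ht (hl0 n)
    obtain ⟨b1, b2⟩ := floor_div_mul_le_and_sub_lt ht (hl0 N)
    have hn1 := hN n hn
    have hn2 := hN N le_rfl
    refine (H (l n) (l N) (hl0 n) hn1.le (hl0 N) hn2.le _ _ a1 b1 ?_).trans_lt (half_lt_self hε)
    rw [abs_le]
    constructor <;> linarith
  choose! u hu using hcau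
  refine ⟨u, fun T hT ε hε => ?_⟩
  obtain ⟨δ, hδ, hδω, H⟩ := hA.exists_norm_iterate_sub_iterate_le hω hx hT hε
  -- Half of δ is reserved for rounding t down to the grid of step `l k`.
  refine ⟨δ / 2, by positivity, by linarith [mul_nonneg hδ.le hω], fun m hm hmδ j hj t ht htj => ?_⟩
  refine le_of_tendsto ((hu t ht.1).sub_const _).norm ?_
  filter_upwards [hlim.eventually (eventually_lt_nhds (half_pos hδ))] with k hk
  obtain ⟨a1, a2⟩ := floor_div_mul_le_and_sub_lt ht.1 (hl0 k)
  refine H (l k) m (hl0 k) (by linarith) hm (by linarith) _ _ (a1.trans ht.2) hj ?_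
  rw [abs_le] at htj ⊢
  constructor <;> linarith

/-- The limit of the Euler schemes is a mild solution, witnessed by exact schemes (g = 0) with
constant step. Continuity follows by comparing u(s) and u(t) with one common iterate. -/
theorem exists_isMildSolution [CompleteSpace X] (hA : IsMAccretive ω A) (hω : 0 ≤ ω)
    (hx : x ∈ closure (dom A)) : ∃ u, IsMildSolution A x u := by
  obtain ⟨u, hu⟩ := hA.exists_forall_norm_sub_iterate_le hω hx
  refine ⟨u, ?_, ?_, ?_⟩
  · intro t ht
    have ht0 : 0 ≤ t := ht
    rw [Metric.continuousWithinAt_iff]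
    intro ε hε
    obtain ⟨δ, hδ, -, H⟩ := hu (t + 1) (by linarith) (ε / 3) (by positivity)
    refine ⟨min (δ / 2) 1, by positivity, fun s hs hst => ?_⟩
    have hs0 : 0 ≤ s := hs
    rw [Real.dist_eq, abs_lt] at hst
    have m1 := min_le_left (δ / 2) 1
    have m2 := min_le_right (δ / 2) 1
    obtain ⟨a1, a2⟩ := floor_div_mul_le_and_sub_lt ht0 (half_pos hδ)
    have h1 := H (δ / 2) (half_pos hδ) (by linarith) ⌊t / (δ / 2)⌋₊ (by linarith) s ⟨hs0, by linarith⟩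
      (abs_le.2 ⟨by linarith, by linarith⟩)
    have h2 := H (δ / 2) (half_pos hδ) (by linarith) ⌊t / (δ / 2)⌋₊ (by linarith) t ⟨ht0, by linarith⟩
      (abs_le.2 ⟨by linarith, by linarith⟩)
    rw [dist_eq_norm]
    rw [norm_sub_rev (u t)] at h2
    refine lt_of_le_of_lt (le_trans (le_of_eq ?_) (norm_add_le _ _))
      ((add_le_add h1 h2).trans_lt (by linarith))
    congr 1; abel
  · refine eq_of_sub_eq_zero (norm_le_zero_iff.1 (le_of_forall_pos_le_add fun ε hε => ?_))
    obtain ⟨δ, hδ, -, H⟩ := hu 0 le_rfl ε hε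
    have := H δ hδ le_rfl 0 (by simp) 0 (by simp) (by simpa using hδ.le)
    simpa using this
  · intro T hT ε hε
    obtain ⟨δ, hδ, hδω, H⟩ := hu T hT.le ε hε
    set m := min δ ε with hm
    have hm0 : 0 < m := lt_min hδ hε
    have hmδ : m ≤ δ := min_le_left _ _
    have hmε : m ≤ ε := min_le_right _ _
    have hmω : m * ω < 1 := by nlinarith
    obtain ⟨a1, a2⟩ := floor_div_mul_le_and_sub_lt hT.le hm0
    have e : ∀ i : ℕ, ((i + 1 : ℕ) : ℝ) * m - i * m = m := fun i => by push_cast; ring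
    refine ⟨⌊T / m⌋₊, fun i => i * m, fun i => (resolv A m)^[i] x, fun _ => 0, by simp,
      fun i _ => ⟨by linarith [e i], by linarith [e i]⟩, by linarith, a1, fun i _ => ?_,
      by simpa using hε.le, by simpa using hε.le, fun i hi s hs => ?_⟩
    · simp only [e, Function.iterate_succ_apply']
      convert! hA.resolv_mem hm0 hmω ((resolv A m)^[i] x) using 2
      rw [zero_sub, ← smul_neg, neg_sub]
    · have hi' : ((i + 1 : ℕ) : ℝ) * m ≤ T := by
        refine le_trans ?_ a1
        gcongr
        omega
      have hs1 := hs.1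
      have hs2 := hs.2
      have hi0 : (0 : ℝ) ≤ i * m := by positivity
      refine H m hm0 hmδ (i + 1) hi' s ⟨by linarith, by linarith⟩ ?_
      rw [abs_le]
      constructor <;> linarith [e i]

end IsMAccretive

/-! ### The trace method -/

theorem mem_effDom_opTrace_iff {x : X} : x ∈ effDom (opTrace A E I) ↔
    ∃ w w' : ℝ → X, IsW11Loc w w' ∧ w 0 = x ∧ E.IsMajorized (I.indicator fun t => ‖w' t‖ₑ) ∧
      E.IsMajorized (I.indicator fun t => setNorm A (w t)) := by
  simp only [effDom, opTrace, traceMethod, mem_ofPred_eq, iInf_lt_iff, ENNReal.add_lt_top,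
    BanachFunctionSpace.extNorm_lt_top_iff_isMajorized, exists_prop]

/-- Test the infimum with v = w(t): ‖x - w(t)‖ ≤ ∫_0^t ‖w'‖, and division by t gives a Hardy
transform. -/
theorem effDom_opTrace_subset_kSet (hI : IsInitialInterval ω c I) (hE : E.HardyBounded) :
    effDom (opTrace A E I) ⊆ kSet A E I := by
  intro x hx
  obtain ⟨w, w', ⟨-, hw⟩, hw0, h0, h1⟩ := mem_effDom_opTrace_iff.1 hx
  rw [mem_kSet_iff hI.isOpen]
  refine ((h0.hardy hE).add h1).mono (Eventually.of_forall fun t => ?_)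
  by_cases ht : t ∈ I
  · have ht0 := hI.pos t ht
    have h0' : ENNReal.ofReal t ≠ 0 := by simpa using ht0
    simp only [indicator_of_mem ht]
    rw [ENNReal.div_le_iff h0' (by simp), add_mul, ENNReal.div_mul_cancel h0' (by simp)]
    refine (iInf_le _ (w t)).trans ?_
    rw [mul_comm]
    gcongr
    have e : x - w t = -∫ s in (0 : ℝ)..t, w' s := by rw [hw t ht0.le, hw0]; abel
    beta_reduce
    rw [e, enorm_neg, intervalIntegral.integral_of_le ht0.le]
    refine (enorm_integral_le_lintegral_enorm _).trans_eq ?_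
    refine setLIntegral_congr_fun measurableSet_Ioc fun s hs => ?_
    simp only [indicator_of_mem (hI.mem_of_le t ht s hs.1 hs.2)]
  · simp [ht]

theorem IsMAccretive.resolvSet_subset_effDom_opTrace [CompleteSpace X] (hA : IsMAccretive ω A)
    (hω : 0 ≤ ω) (hX : HasRadonNikodymProperty X) {τ : ℝ} (hτ : 0 < τ) (hτω : τ * ω < 1) :
    resolvSet A E (Ioo 0 τ) ⊆ effDom (opTrace A E (Ioo 0 τ)) := by
  intro x hx
  have hI := isInitialInterval_Ioo hω hτ hτω
  have hcl := hA.resolvSet_subset_closure hI hx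
  -- Absolute continuity up to and including τ, possible because τω < 1 and q is integrable on (0,
  -- τ).
  have hac := hA.absolutelyContinuousOnInterval_resolvCurve hω hτω hcl hτ.le le_rfl
    (hA.integrableOn_quotient hI hx Subset.rfl)
  obtain ⟨g, hg, hfg⟩ := hX τ hτ _ hac
  rw [hA.mem_resolvSet_iff hI] at hx
  rw [mem_effDom_opTrace_iff]
  have e : ∀ t ∈ Ioo 0 τ, resolvCurve A x (min t τ) = resolv A t x := fun t ht => by
    rw [min_eq_left ht.2.le, resolvCurve_of_pos A x ht.1]
  -- By Lebesgue differentiation the density g is almost everywhere the derivative of the curve, so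
  -- the local Lipschitz bound applies to it.
  have hbound : ∀ᵐ t, t ∈ Ioo 0 τ → ‖g t‖ ≤ ‖x - resolv A t x‖ / t / (1 - τ * ω) ^ 2 := by
    have hgi : IntervalIntegrable g volume 0 τ := by
      rwa [intervalIntegrable_iff_integrableOn_Ioc_of_le hτ.le]
    filter_upwards [hgi.ae_hasDerivAt_integral] with t hd ht
    have htI : t ∈ uIcc 0 τ := by rw [uIcc_of_le hτ.le]; exact Ioo_subset_Icc_self ht
    have h1 := (hd htI 0 left_mem_uIcc).const_add (resolvCurve A x 0)
    have h2 : HasDerivAt (resolvCurve A x) (g t) t := by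
      refine h1.congr_of_eventuallyEq ?_
      filter_upwards [isOpen_Ioo.mem_nhds ht] with s hs
      exact hfg s (Ioo_subset_Icc_self hs)
    rw [← h2.deriv]
    exact hA.norm_deriv_resolvCurve_le hω hI x ht
  refine ⟨fun t => resolvCurve A x (min t τ), (Ioc 0 τ).indicator g, ⟨fun T hT => ?_, fun t ht => ?_⟩,
    ?_, ?_, hx.mono (Eventually.of_forall fun t => ?_)⟩
  · exact ((integrable_indicator_iff measurableSet_Ioc).2 hg).integrableOn
  · have h1 : min t τ ∈ Icc 0 τ := ⟨le_min ht hτ.le, min_le_right _ _⟩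
    simp only [min_eq_left hτ.le]
    rw [hfg _ h1, intervalIntegral.integral_of_le ht, intervalIntegral.integral_of_le h1.1,
      setIntegral_indicator measurableSet_Ioc, Ioc_inter_Ioc, max_self]
  · simp [min_eq_left hτ.le, resolvCurve_zero]
  · have hc : 0 < 1 - τ * ω := by linarith
    refine (hx.const_mul (c := ENNReal.ofReal ((1 - τ * ω) ^ 2)⁻¹) (by simp)).mono ?_
    filter_upwards [ae_restrict_of_ae hbound] with t hb
    by_cases ht : t ∈ Ioo 0 τ
    · simp only [indicator_of_mem ht, indicator_of_mem (Ioo_subset_Ioc_self ht)]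
      rw [← ofReal_norm, ← ENNReal.ofReal_mul (by positivity), inv_mul_eq_div]
      exact ENNReal.ofReal_le_ofReal (hb ht)
    · simp [ht]
  · by_cases ht : t ∈ Ioo 0 τ
    · simp only [indicator_of_mem ht, e t ht]
      exact hA.setNorm_resolv_le ht.1 (hI.mul_lt_one ht) x
    · simp [ht]

end AccretiveInterpolation

/-! ### The corollary, with D the resolvent set of A on (0, τ) -/

theorem mainTheorem5 {X : Type*} [NormedAddCommGroup X] [NormedSpace ℝ X] [CompleteSpace X]
    (ω : ℝ) (hω : 0 ≤ ω) (A : Set (X × X)) (hA : IsMAccretive ω A)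
    (E : BanachFunctionSpace) (hE : E.HardyBounded)
    (τ h : ℝ) (hτ : 0 < τ) (hτω : τ * ω < 1) (hh : 0 < h) (hhω : h * ω < 1) :
    dom A ⊆ resolvSet A E (Ioo 0 τ) ∧
    resolvSet A E (Ioo 0 τ) = resolvSet (idAdd h A) E (Ioi 0) ∧
    resolvSet A E (Ioo 0 τ) = semigroupSet A E (Ioo 0 τ) ∧
    resolvSet A E (Ioo 0 τ) = semigroupSet (idAdd h A) E (Ioo 0 τ) ∧
    resolvSet A E (Ioo 0 τ) = kSet A E (Ioo 0 τ) ∧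
    resolvSet A E (Ioo 0 τ) = effDom (opK A E (Ioo 0 τ)) ∧
    resolvSet A E (Ioo 0 τ) = kSet (idAdd h A) E (Ioo 0 τ) ∧
    resolvSet A E (Ioo 0 τ) = effDom (opK (idAdd h A) E (Ioo 0 τ)) ∧
    resolvSet A E (Ioo 0 τ) = kSet (idAdd h A) E (Ioi 0) ∧
    resolvSet A E (Ioo 0 τ) = effDom (opK (idAdd h A) E (Ioi 0)) ∧
    resolvSet A E (Ioo 0 τ) = variationSet A E (Ioo 0 τ) ∧
    resolvSet A E (Ioo 0 τ) = acVariationSet A E (Ioo 0 τ) ∧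
    resolvSet A E (Ioo 0 τ) = variationSet (idAdd h A) E (Ioi 0) ∧
    resolvSet A E (Ioo 0 τ) = acVariationSet (idAdd h A) E (Ioi 0) ∧
    resolvSet A E (Ioo 0 τ) = effDom (opMean A E (measurableFunctions X) (Ioo 0 τ)) ∧
    resolvSet A E (Ioo 0 τ) = effDom (opMean A E (continuousFunctions X) (Ioo 0 τ)) ∧
    resolvSet A E (Ioo 0 τ) =
      effDom (opMean (idAdd h A) E (measurableFunctions X) (Ioo 0 τ)) ∧
    resolvSet A E (Ioo 0 τ) =
      effDom (opMean (idAdd h A) E (continuousFunctions X) (Ioo 0 τ)) ∧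
    resolvSet A E (Ioo 0 τ) ⊆ closure (dom A) ∧
    (HasRadonNikodymProperty X →
      effDom (opK A E (Ioo 0 τ)) = effDom (opTrace A E (Ioo 0 τ))) := by
  have hB : IsMAccretive 0 (idAdd h A) := hA.idAdd hω hh hhω
  have hI := isInitialInterval_Ioo hω hτ hτω
  have hτ0 : τ * 0 < 1 := by simp
  have hI0 := isInitialInterval_Ioo le_rfl hτ hτ0
  have hJ := isInitialInterval_Ioi
  obtain ⟨v, hv⟩ := hA.exists_zero_idAdd hh hhω
  have eA := hA.resolvSet_eq_kSet (E := E) hω hI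
  have eB := hB.resolvSet_eq_kSet (E := E) le_rfl hI0
  have eJ := hB.resolvSet_eq_kSet (E := E) le_rfl hJ
  -- The K-sets are the bridge between A and I + hA and between (0, τ) and (0, ∞); the resolvent
  -- sets follow from them.
  have eAB : kSet A E (Ioo 0 τ) = kSet (idAdd h A) E (Ioo 0 τ) := kSet_idAdd hh hτ
  have eBJ := kSet_Ioi_eq_of_zero hE hv hτ
  have hRB : resolvSet A E (Ioo 0 τ) = resolvSet (idAdd h A) E (Ioo 0 τ) := by rw [eA, eAB, eB]
  have hRJ : resolvSet A E (Ioo 0 τ) = resolvSet (idAdd h A) E (Ioi 0) := by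
    rw [eA, eAB, eBJ, eJ]
  refine ⟨hA.dom_subset_resolvSet hω hτ hτω, hRJ, ?_, ?_, eA, ?_, hRB.trans eB, ?_, hRJ.trans eJ,
    ?_, hA.resolvSet_eq_variationSet hω hI hE, hA.resolvSet_eq_acVariationSet hω hI hE,
    hRJ.trans (hB.resolvSet_eq_variationSet le_rfl hJ hE),
    hRJ.trans (hB.resolvSet_eq_acVariationSet le_rfl hJ hE),
    hA.resolvSet_eq_effDom_opMean hω hτ hτω continuousFunctions_subset_measurableFunctions,
    hA.resolvSet_eq_effDom_opMean hω hτ hτω Subset.rfl,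
    hRB.trans (hB.resolvSet_eq_effDom_opMean le_rfl hτ hτ0
      continuousFunctions_subset_measurableFunctions),
    hRB.trans (hB.resolvSet_eq_effDom_opMean le_rfl hτ hτ0 Subset.rfl),
    hA.resolvSet_subset_closure hI, fun hX => ?_⟩
  · exact hA.resolvSet_eq_semigroupSet hω hE hτ hτω fun x hx => hA.exists_isMildSolution hω hx
  · exact hRB.trans (hB.resolvSet_eq_semigroupSet le_rfl hE hτ hτ0
      fun x hx => hB.exists_isMildSolution le_rfl hx)
  · rw [effDom_opK isOpen_Ioo, eA]
  · rw [effDom_opK isOpen_Ioo, hRB, eB]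
  · rw [effDom_opK isOpen_Ioi, hRJ, eJ]
  · rw [effDom_opK isOpen_Ioo]
    exact Subset.antisymm (eA.symm.subset.trans (hA.resolvSet_subset_effDom_opTrace hω hX hτ hτω))
      (effDom_opTrace_subset_kSet hI hE)
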